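/- **Setting.** A $\dagger$-Frobenius algebra $Z$ on a finite-dimensional complex Hilbert space $H$ is a monoid $(\mu_Z,\eta_Z)$ on $H$ satisfying the Frobenius law with its adjoint comonoid $(\delta_Z,\epsilon_Z)=(\mu_Z^\dagger,\eta_Z^\dagger)$. It is quasi-special if $\mu_Z\delta_Z=c\cdot\mathrm{id}$ with $c>0$, and special if $c=1$. A state $\psi$ is $Z$-classical if $\delta_Z\psi=\psi\otimes\psi$, $\epsilon_Z\mu_Z(\psi\otimes-)=\langle\psi|$ and $\epsilon_Z\psi=1$. A state $u$ is a $Z$-phase state if $(\langle u|\otimes\mathrm{id})\delta_Z u=\eta_Z$; its phase gate is $P_u=\mu_Z(u\otimes -)$. Phase states, considered up to global phase, form a group under $\mu_Z,\eta_Z$. The pair $(Z,X)$ is strongly complementary if its antipode $s=(\epsilon_Z\mu_Z\otimes\mathrm{id})(\mathrm{id}\otimes\delta_X\eta_X)$ is a self-adjoint unitary, Hopf's law $\mu_Z(\mathrm{id}\otimes s)\delta_X=\eta_Z\epsilon_X$ holds, $\delta_X\eta_Z=\eta_Z\otimes\eta_Z$, $\epsilon_X\eta_Z=1$, $\epsilon_X\mu_Z=\epsilon_X\otimes\epsilon_X$,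 and $\delta_X\mu_Z=(\mu_Z\otimes\mu_Z)(\mathrm{id}\otimes\mathrm{swap}\otimes\mathrm{id})(\delta_X\otimes\delta_X)$. Let $K$ be a finite abelian group. A finite system $\mathcal S$ of $\mathbb Z$-module equations valued in $K$ is $\sum_{r=1}^M n^s_r\,y_r=a^s$ ($s=1,\dots,S$) with $n^s_r\in\mathbb Z$, $a^s\in K$. It is *consistent* if, for all $c\in\mathbb Z^S$, $\sum_s c_s\underline n^s=0$ in $\mathbb Z^M$ implies $\sum_s c_sa^s=0$ in $K$. A *(quantum) generalised Mermin-type argument* for a system $\mathcal S$ with all $n^s_r\ge0$ consists of: a strongly complementary pair $(Z,X)$ on $H$, $Z$ commutative quasi-special and $X$ commutative special with enough classical states (they separate linear maps out of $H$), together with an isomorphism between $K$ and the group of $X$-classical states under $(\mu_Z,\eta_Z)$; a solution $(\beta_r)_r$ of $\mathcal S$ in the group of $Z$-phase states up to global phase; and an *admissible* $N$, i.e. a positive integer $N\ge\sum_r n^s_r$ for all $s$, coprime to $\exp K$. Put $n^s_0=N-\sum_{r\ge1} n^s_r$ and $\beta_0=\eta_Z$. The $N$ parties share the normalised $N$-partite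 $Z$-GHZ state; on measurement choice $m\in\{0,\dots,M\}$ a party applies the phase gate $P_{\beta_m}$ and measures in $X$, with outcome in $K$. The measurement contexts are the control (all parties choose $0$) and, for each $s$, the $N$ cyclic permutations of the joint choice in which the first $n_0^s$ parties choose $0$, the next $n^s_1$ choose $1$, ..., and the last $n^s_M$ choose $M$; the measurements of the scenario are the (party, choice) pairs that occur in some context. The *empirical model of the argument* assigns to each context the Born-rule probabilities of the joint outcomes. For a commutative ring $\mathcal R$ and an $\mathcal R$-module $G$, a possibilistic (no-signalling) empirical model with outcomes in $G$ is $\mathrm{AvN}_{\mathcal R,G}$ if no global assignment of elements of $G$ to the measurements satisfies, for every context $C$, all $\mathcal R$-linear equations with variables in $C$ that hold for every section over $C$ of the support subpresheaf of the model (that is, for every possible joint outcome of $C$). A probabilistic model is $\mathrm{AvN}_{\mathcal R,G}$ if its possibilistic collapse is. Write $\mathrm{AvN}_{\mathcal R}$ for $\mathrm{AvN}_{\mathcal R,\mathcal R}$. **Statement.** 1. For every finite abelian group $K$ and every generalised Mermin-type argument for a system valued in $K$ with no solution in $K$, the Born-rule probabilities form a (no-signalling) probabilistic empirical model, and this model is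 $\mathrm{AvN}_{\mathbb Z,K}$. 2. For every finite abelian group $K$ and every finite consistent system $\mathcal S$ of $\mathbb Z$-module equations valued in $K$ with no solution in $K$, there is a consistent system $\mathcal S'$, with no solution in $K$, with the same right-hand sides and with nonnegative coefficients congruent to those of $\mathcal S$ modulo $\exp K$ (hence equivalent to $\mathcal S$ over $K$), and with $\mathcal S'=\mathcal S$ if the coefficients of $\mathcal S$ are already nonnegative, such that: infinitely many $N$ are admissible for $\mathcal S'$, and for every admissible $N$ and every $|K|$-dimensional Hilbert space $H$ there is a generalised Mermin-type argument on $H$ with $N$ parties for $\mathcal S'$, whose empirical model is $\mathrm{AvN}_{\mathbb Z,K}$. 3. This family is infinite: for every nontrivial finite abelian group $K$ there is a finite consistent system of $\mathbb Z$-module equations valued in $K$ with no solution in $K$. 4. For every finite abelian group $K$ and every positive integer $n$ divisible by $\exp K$, a possibilistic empirical model with outcomes in $K$ is $\mathrm{AvN}_{\mathbb Z,K}$ if and only if it is $\mathrm{AvN}_{\mathbb Z_n,K}$. 5. For every $n\ge2$ there are $N$ and a finite consistent system $\mathcal S$ of $\mathbb Z$-module equations valued in $\mathbb Z_n$, with no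 solution in $\mathbb Z_n$, such that on every $n$-dimensional Hilbert space there is a generalised Mermin-type argument for $\mathcal S$ with $N$ parties whose empirical model is $\mathrm{AvN}_{\mathbb Z_n}$. -/

import Mathlib

open scoped TensorProduct NNReal InnerProductSpace

universe u v w

noncomputable section

namespace Mermin

/-! ## Distributions over a commutative semiring -/

/-- An `R`-distribution on `U`: a finitely supported function `U → R` with total weight `1`. -/
structure RDist (R : Type*) [CommSemiring R] (U : Type*) where
  wt : U →₀ R
  total : wt.sum (fun _ r => r) = 1

/-- Push-forward of an `R`-distribution along a function. -/
def RDist.map {R : Type*} [CommSemiring R] {U V : Type*} (f : U → V) (d : RDist R U) :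
    RDist R V where
  wt := d.wt.mapDomain f
  total := by
    rw [Finsupp.sum_mapDomain_index (by simp) (by simp)]
    exact d.total

/-- Change of semiring along a homomorphism `R → R'`. -/
def RDist.changeSemiring {R R' : Type*} [CommSemiring R] [CommSemiring R'] (r : R →+* R')
    {U : Type*} (d : RDist R U) : RDist R' U where
  wt := d.wt.mapRange r (map_zero r)
  total := by
    rw [Finsupp.sum_mapRange_index (by simp), ← map_one r, ← d.total, Finsupp.sum, Finsupp.sum,
      map_sum]

/-- The semiring of booleans `({0, 1}, ∨, 0, ∧, 1)`. -/
def Poss : Type := Bool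

instance : Zero Poss := ⟨false⟩
instance : One Poss := ⟨true⟩
instance : Add Poss := ⟨Bool.or⟩
instance : Mul Poss := ⟨Bool.and⟩

instance : CommSemiring Poss where
  add_assoc := Bool.or_assoc
  zero_add := Bool.false_or
  add_zero := Bool.or_false
  add_comm := Bool.or_comm
  mul_assoc := Bool.and_assoc
  one_mul := Bool.true_and
  mul_one := Bool.and_true
  zero_mul := Bool.false_and
  mul_zero := Bool.and_false
  left_distrib := Bool.and_or_distrib_left
  right_distrib := Bool.and_or_distrib_right
  mul_comm := Bool.and_comm
  nsmul := nsmulRec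
  npow := fun n a => npowRec n a

open Classical in
/-- The semiring homomorphism `ℝ≥0 → {0, 1}` sending `0` to `0` and everything else to `1`. -/
def possHom : ℝ≥0 →+* Poss where
  toFun x := if x = 0 then 0 else 1
  map_one' := by simp
  map_zero' := by simp
  map_mul' x y := by
    by_cases hx : x = 0 <;> by_cases hy : y = 0 <;> simp [hx, hy]
  map_add' x y := by
    have h : (1 : Poss) = 1 + 1 := rfl
    by_cases hx : x = 0 <;> by_cases hy : y = 0 <;> simp [hx, hy]
    exact h

/-! ## Measurement scenarios and empirical models -/

/-- A measurement scenario on the set `X` of measurements: a global cover of `X` by measurement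
contexts. -/
structure Scenario (X : Type*) where
  contexts : Set (Finset X)
  cover : ∀ x, ∃ C ∈ contexts, x ∈ C

/-- Restriction of sections (joint outcomes) over `U` to sections over `V ⊆ U`. -/
def restrict {X : Type*} (O : Type*) {V U : Finset X} (h : V ⊆ U) (s : U → O) : V → O :=
  fun x => s ⟨x.1, h x.2⟩

/-- A no-signalling empirical model: a compatible family of `R`-distributions on the joint outcomes
of the measurement contexts. All measurements have outcomes in `O`. -/
structure EmpiricalModel {X : Type*} [DecidableEq X] (𝒮c : Scenario X)
    (R : Type*) [CommSemiring R] (O : Type*) where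
  dist : (C : 𝒮c.contexts) → RDist R (C.1 → O)
  compatible : ∀ C C' : 𝒮c.contexts,
    (dist C).map (restrict O (Finset.inter_subset_left (s₁ := C.1) (s₂ := C'.1))) =
      (dist C').map (restrict O (Finset.inter_subset_right (s₁ := C.1) (s₂ := C'.1)))

section Models

variable {X : Type*} [DecidableEq X] {𝒮c : Scenario X} {O : Type*}

/-- The possibilistic empirical model associated with a probabilistic one. -/
def EmpiricalModel.collapse (ζ : EmpiricalModel 𝒮c ℝ≥0 O) : EmpiricalModel 𝒮c Poss O where
  dist C := (ζ.dist C).changeSemiring possHom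
  compatible C C' := by
    have h := congrArg RDist.wt (ζ.compatible C C')
    simp only [RDist.map, RDist.changeSemiring, RDist.mk.injEq] at h ⊢
    rw [Finsupp.mapDomain_mapRange _ _ _ _ (map_add possHom),
      Finsupp.mapDomain_mapRange _ _ _ _ (map_add possHom), h]

/-- The support subpresheaf of a possibilistic empirical model, evaluated at `U`: the sections over
`U` all of whose restrictions to `C ∩ U` are possible according to the marginal of `ζ_C`. -/
def EmpiricalModel.supp (ζ : EmpiricalModel 𝒮c Poss O) (U : Finset X) : Set (U → O) :=
  {s | ∀ C : 𝒮c.contexts,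
    restrict O (Finset.inter_subset_right (s₁ := C.1) (s₂ := U)) s ∈
      ((ζ.dist C).map (restrict O (Finset.inter_subset_left (s₁ := C.1) (s₂ := U)))).wt.support}

end Models

/-! ## All-vs-Nothing arguments -/

/-- An `R`-linear equation valued in `G`, with finite index set `C`. -/
structure LinEq {X : Type*} (R G : Type*) (C : Finset X) where
  coeff : C → R
  rhs : G

section AvN

variable {X : Type*} (R G : Type*) [CommRing R] [AddCommGroup G] [Module R G]

/-- The assignment `s : C → G` satisfies the equation `φ`. -/
def LinEq.SatisfiedBy {R G : Type*} [CommRing R] [AddCommGroup G] [Module R G] {C : Finset X}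
    (φ : LinEq R G C) (s : C → G) : Prop :=
  ∑ m : C, φ.coeff m • s m = φ.rhs

/-- The `R`-linear theory of a set `W` of assignments: all equations satisfied by all of `W`. -/
def linTheory {C : Finset X} (W : Set (C → G)) : Set (LinEq R G C) :=
  {φ | ∀ s ∈ W, φ.SatisfiedBy s}

/-- A possibilistic empirical model with outcomes in the `R`-module `G` is `AvN_{R,G}`: no global
assignment satisfies the `R`-linear theory of its support subpresheaf. -/
def EmpiricalModel.IsAvN [DecidableEq X] {𝒮c : Scenario X} (ζ : EmpiricalModel 𝒮c Poss G) : Prop :=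
  ¬ ∃ s : X → G, ∀ C ∈ 𝒮c.contexts, ∀ φ ∈ linTheory R G (ζ.supp C),
    φ.SatisfiedBy (fun x : C => s x)

end AvN

/-- The `ℤ/n`-module structure on an abelian group whose exponent divides `n`. -/
@[reducible] def zmodModule (K : Type*) [AddCommGroup K] (n : ℕ)
    (h : AddMonoid.exponent K ∣ n) : Module (ZMod n) K :=
  AddCommGroup.zmodModule (n := n) fun x =>
    addOrderOf_dvd_iff_nsmul_eq_zero.mp ((AddMonoid.addOrder_dvd_exponent x).trans h)

/-! ## Systems of integer equations in an abelian group -/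

/-- A system of `S` equations `∑ r, n s r • y r = a s` in `M` unknowns, with integer coefficients,
valued in `K`. -/
structure IntSystem (K : Type*) (S M : ℕ) where
  coeff : Fin S → Fin M → ℤ
  rhs : Fin S → K

namespace IntSystem

variable {K : Type*} [AddCommGroup K] {S M : ℕ} (𝒮 : IntSystem K S M)

/-- Every integer relation between the rows is satisfied by the right-hand sides. -/
def Consistent : Prop :=
  ∀ c : Fin S → ℤ, (∀ r, ∑ s, c s * 𝒮.coeff s r = 0) → ∑ s, c s • 𝒮.rhs s = 0

/-- The system has a solution in `K`. -/
def Solvable : Prop :=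
  ∃ y : Fin M → K, ∀ s, ∑ r, 𝒮.coeff s r • y r = 𝒮.rhs s

/-- Numbers of parties allowed for the system. -/
def Admissible (N : ℕ) : Prop :=
  0 < N ∧ (∀ s, ∑ r, 𝒮.coeff s r ≤ N) ∧ Nat.Coprime N (AddMonoid.exponent K)

end IntSystem

/-! ## The measurement scenario of a generalised Mermin-type argument -/

section MerminScenario

variable {K : Type*} {S M : ℕ} (𝒮 : IntSystem K S M) (N : ℕ)

/-- The multiplicities `n₀, n₁, …, n_M` of the zero-padded `s`-th equation, where
`n₀ = N - (n₁ + ⋯ + n_M)`. Used only for nonnegative coefficients of sum at most `N`. -/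
def padded (s : Fin S) : Fin (M + 1) → ℕ :=
  Fin.cons (N - ∑ r, (𝒮.coeff s r).toNat) (fun r => (𝒮.coeff s r).toNat)

/-- The choice of party `j` (parties being numbered from `0`) in the first variation for `s`: the
largest `m ∈ {0, …, M}` such that `n₀ + ⋯ + n_{m-1} ≤ j`. Thus the first `n₀` parties choose `0`,
the next `n₁` parties choose `1`, and so on. -/
def firstChoice (s : Fin S) (j : ℕ) : Fin (M + 1) :=
  (Finset.univ.filter fun m : Fin (M + 1) =>
    ∑ r ∈ Finset.univ.filter (· < m), padded 𝒮 N s r ≤ j).sup id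

/-- The joint choices of the `k`-th variation for `s`: the `k`-th cyclic permutation of the first
variation. -/
def variation (s : Fin S) (k : Fin N) : Fin N → Fin (M + 1) :=
  fun j => firstChoice 𝒮 N s ((j.1 + k.1) % N)

/-- The joint measurement choices used: the control (everyone chooses `0`) and the variations. -/
def jointChoices : Set (Fin N → Fin (M + 1)) :=
  {m | m = (fun _ => 0) ∨ ∃ s k, m = variation 𝒮 N s k}

/-- The measurements: pairs (party, choice) which occur in some joint choice. -/
abbrev Meas : Type :=
  {x : Fin N × Fin (M + 1) // ∃ m ∈ jointChoices 𝒮 N, m x.1 = x.2}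

variable {𝒮 N}

/-- The measurement made by party `j` in the joint choice `m`. -/
def meas {m : Fin N → Fin (M + 1)} (hm : m ∈ jointChoices 𝒮 N) (j : Fin N) : Meas 𝒮 N :=
  ⟨(j, m j), m, hm, rfl⟩

/-- The measurement context of the joint choice `m`. -/
def context {m : Fin N → Fin (M + 1)} (hm : m ∈ jointChoices 𝒮 N) : Finset (Meas 𝒮 N) :=
  Finset.univ.image (meas hm)

lemma meas_mem_context {m : Fin N → Fin (M + 1)} (hm : m ∈ jointChoices 𝒮 N) (j : Fin N) :
    meas hm j ∈ context hm :=
  Finset.mem_image_of_mem _ (Finset.mem_univ j)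

variable (𝒮 N)

/-- The measurement scenario: the control and the variations. -/
def merminScenario : Scenario (Meas 𝒮 N) where
  contexts := {C | ∃ (m : Fin N → Fin (M + 1)) (hm : m ∈ jointChoices 𝒮 N), C = context hm}
  cover := by
    rintro ⟨⟨j, i⟩, m, hm, h⟩
    refine ⟨context hm, ⟨m, hm, rfl⟩, ?_⟩
    have hx : (⟨(j, i), m, hm, h⟩ : Meas 𝒮 N) = meas hm j :=
      Subtype.ext (Prod.ext rfl h.symm)
    rw [hx]
    exact meas_mem_context hm j

end MerminScenario

/-! ## Dagger Frobenius algebras on finite-dimensional Hilbert spaces -/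

variable (H : Type v) [NormedAddCommGroup H] [InnerProductSpace ℂ H] [FiniteDimensional ℂ H]

/-- A `†`-Frobenius algebra on `H`. The comonoid is the adjoint of the monoid, and the two Frobenius
equations hold. -/
structure DaggerFrobenius where
  mul : H ⊗[ℂ] H →ₗ[ℂ] H
  unit : H
  mul_assoc : ∀ x y z, mul (mul (x ⊗ₜ y) ⊗ₜ z) = mul (x ⊗ₜ mul (y ⊗ₜ z))
  unit_mul : ∀ x, mul (unit ⊗ₜ x) = x
  mul_unit : ∀ x, mul (x ⊗ₜ unit) = x
  frobenius_left :
    mul.rTensor H ∘ₗ (TensorProduct.assoc ℂ H H H).symm.toLinearMap ∘ₗ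
      (LinearMap.adjoint mul).lTensor H = LinearMap.adjoint mul ∘ₗ mul
  frobenius_right :
    mul.lTensor H ∘ₗ (TensorProduct.assoc ℂ H H H).toLinearMap ∘ₗ
      (LinearMap.adjoint mul).rTensor H = LinearMap.adjoint mul ∘ₗ mul

namespace DaggerFrobenius

variable {H}
variable (Z X : DaggerFrobenius H)

/-- Comultiplication. -/
def comul : H →ₗ[ℂ] H ⊗[ℂ] H := LinearMap.adjoint Z.mul

/-- Counit: the adjoint of the unit. -/
def counit : H →ₗ[ℂ] ℂ := innerₛₗ ℂ Z.unit

/-- Commutativity of the monoid; that of the comonoid follows by taking adjoints. -/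
def IsCommutative : Prop := ∀ x y, Z.mul (x ⊗ₜ y) = Z.mul (y ⊗ₜ x)

/-- The comultiplication is an isometry. -/
def IsSpecial : Prop := Z.mul ∘ₗ Z.comul = LinearMap.id

/-- The comultiplication is an isometry up to a normalisation factor `n† n`, `n` invertible. -/
def IsQuasiSpecial : Prop :=
  ∃ n : ℂ, n ≠ 0 ∧ Z.mul ∘ₗ Z.comul = (star n * n) • (LinearMap.id : H →ₗ[ℂ] H)

/-- Classical states: those which are copied, transposed and deleted. -/
def IsClassical (ψ : H) : Prop :=
  Z.comul ψ = ψ ⊗ₜ ψ ∧ (∀ φ, Z.counit (Z.mul (ψ ⊗ₜ φ)) = ⟪ψ, φ⟫_ℂ) ∧ Z.counit ψ = 1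

/-- Classical states separate morphisms. -/
def HasEnoughClassical : Prop :=
  ∀ (B : Type v) [NormedAddCommGroup B] [InnerProductSpace ℂ B] [FiniteDimensional ℂ B]
    (f g : H →ₗ[ℂ] B), (∀ ψ, Z.IsClassical ψ → f ψ = g ψ) → f = g

/-- Unbiased states, also called phase states: `(⟨u| ⊗ id) (comul u) = unit`. -/
def IsPhaseState (u : H) : Prop :=
  TensorProduct.lid ℂ H ((innerₛₗ ℂ u : H →ₗ[ℂ] ℂ).rTensor H (Z.comul u)) = Z.unit

/-- The phase gate of a phase state: multiplication by it. -/
def gate (u : H) : Module.End ℂ H := Z.mul ∘ₗ TensorProduct.mk ℂ H H u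

/-- The antipode: the cap of `Z` composed with the cup of `X`. -/
def antipode : H →ₗ[ℂ] H :=
  (TensorProduct.lid ℂ H).toLinearMap ∘ₗ (Z.counit ∘ₗ Z.mul).rTensor H ∘ₗ
    (TensorProduct.assoc ℂ H H H).symm.toLinearMap ∘ₗ
      (TensorProduct.mk ℂ H (H ⊗[ℂ] H)).flip (X.comul X.unit)

/-- Complementarity: the antipode is a self-adjoint unitary, and Hopf's law holds. -/
structure Complementary : Prop where
  antipode_selfAdjoint : ∀ x y, ⟪antipode Z X x, y⟫_ℂ = ⟪x, antipode Z X y⟫_ℂ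
  antipode_involutive : ∀ x, antipode Z X (antipode Z X x) = x
  hopf : ∀ x, Z.mul ((antipode Z X).lTensor H (X.comul x)) = X.counit x • Z.unit

/-- Strong complementarity. -/
structure StronglyComplementary : Prop extends Complementary Z X where
  comul_unit : X.comul Z.unit = Z.unit ⊗ₜ Z.unit
  counit_unit : X.counit Z.unit = 1
  comul_mul : X.comul ∘ₗ Z.mul =
    TensorProduct.map Z.mul Z.mul ∘ₗ
      (TensorProduct.tensorTensorTensorComm ℂ H H H H).toLinearMap ∘ₗ
        TensorProduct.map X.comul X.comul
  counit_mul : ∀ x y, X.counit (Z.mul (x ⊗ₜ y)) = X.counit x * X.counit y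

/-- The `n`-fold comultiplication `H → H ⊗ ⋯ ⊗ H` (the counit for `n = 0`). -/
def copies : (n : ℕ) → H →ₗ[ℂ] (⨂[ℂ]^n H)
  | 0 => (PiTensorProduct.isEmptyEquiv (Fin 0)).symm.toLinearMap ∘ₗ Z.counit
  | n + 1 => TensorPower.mulEquiv.toLinearMap ∘ₗ
      TensorProduct.map (copies n) (PiTensorProduct.subsingletonEquiv (0 : Fin 1)).symm.toLinearMap
        ∘ₗ Z.comul

/-- The (unnormalised) `N`-partite GHZ state. -/
def ghz (N : ℕ) : ⨂[ℂ]^N H := Z.copies N Z.unit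

end DaggerFrobenius

/-! ## Generalised Mermin-type arguments in quantum theory -/

/-- The functional `⟨x₁| ⊗ ⋯ ⊗ ⟨x_N|` on the `N`-fold tensor power. -/
def bra {H : Type v} [NormedAddCommGroup H] [InnerProductSpace ℂ H] {N : ℕ} (x : Fin N → H) :
    (⨂[ℂ]^N H) →ₗ[ℂ] ℂ :=
  PiTensorProduct.dualDistrib (PiTensorProduct.tprod ℂ fun j => (innerₛₗ ℂ (x j) : H →ₗ[ℂ] ℂ))

/-- A generalised Mermin-type argument in quantum theory, on the Hilbert space `H`, with `N`
parties, for the system `𝒮`. The group of `X`-classical states, under the multiplication of `Z`, is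
identified with the group `K` in which the system is valued by the isomorphism `label`.
The given solution `β` of the system in the group of `Z`-phase states is a family of
representatives; states are considered up to global phase. -/
structure MerminArgument {K : Type u} [AddCommGroup K] {S M : ℕ}
    (𝒮 : IntSystem K S M) (N : ℕ) where
  Z : DaggerFrobenius H
  X : DaggerFrobenius H
  Z_comm : Z.IsCommutative
  Z_quasiSpecial : Z.IsQuasiSpecial
  X_comm : X.IsCommutative
  X_special : X.IsSpecial
  stronglyComplementary : Z.StronglyComplementary X
  X_enough : X.HasEnoughClassical
  label : K ≃ {ψ : H // X.IsClassical ψ}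
  label_zero : (label 0 : H) = Z.unit
  label_add : ∀ g h, (label (g + h) : H) = Z.mul ((label g : H) ⊗ₜ (label h : H))
  coeff_nonneg : ∀ s r, 0 ≤ 𝒮.coeff s r
  admissible : 𝒮.Admissible N
  β : Fin M → H
  β_phase : ∀ r, Z.IsPhaseState (β r)
  β_solution : ∀ s, ∃ z : ℂ, ‖z‖ = 1 ∧
    (List.ofFn fun r => Z.gate (β r) ^ (𝒮.coeff s r).toNat).prod Z.unit = z • (label (𝒮.rhs s) : H)

namespace MerminArgument

variable {H} {K : Type u} [AddCommGroup K] {S M : ℕ} {𝒮 : IntSystem K S M} {N : ℕ}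
variable (A : MerminArgument H 𝒮 N)

/-- The phase state applied for each measurement choice; choice `0` is the trivial phase. -/
def phase : Fin (M + 1) → H := Fin.cons A.Z.unit A.β

/-- The global state before measurement: party `j` applies the phase gate of her choice `m j` to
her part of the GHZ state. -/
def state (m : Fin N → Fin (M + 1)) : ⨂[ℂ]^N H :=
  PiTensorProduct.map (fun j => A.Z.gate (A.phase (m j))) (A.Z.ghz N)

/-- Born rule: the probability of the joint outcome `g` when all parties measure in the observable
`X` after the joint choice `m`. The factor `1 / |K| ^ (N - 1)` normalises the GHZ state. -/
def born (m : Fin N → Fin (M + 1)) (g : Fin N → K) : ℝ≥0 :=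
  ‖bra (fun j => (A.label (g j) : H)) (A.state m)‖₊ ^ 2 / (Nat.card K : ℝ≥0) ^ (N - 1)

/-- The empirical model `ζ` is the one given by the quantum argument `A`. -/
def Realises (ζ : EmpiricalModel (merminScenario 𝒮 N) ℝ≥0 K) : Prop :=
  ∀ (m : Fin N → Fin (M + 1)) (hm : m ∈ jointChoices 𝒮 N) (o : context hm → K),
    (ζ.dist ⟨context hm, m, hm, rfl⟩).wt o =
      A.born m fun j => o ⟨meas hm j, meas_mem_context hm j⟩

end MerminArgument

end Mermin

end

open Mermin

noncomputable section

namespace Mermin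

/-! ## The commutative monoid of a commutative Frobenius algebra -/

namespace DaggerFrobenius

variable {H : Type v} [NormedAddCommGroup H] [InnerProductSpace ℂ H] [FiniteDimensional ℂ H]

/-- The multiplicative structure on the Hilbert space of a commutative Frobenius algebra. -/
@[reducible] def commMonoid (Z : DaggerFrobenius H) (hZ : Z.IsCommutative) : CommMonoid H where
  mul x y := Z.mul (x ⊗ₜ y)
  mul_assoc := Z.mul_assoc
  one := Z.unit
  one_mul := Z.unit_mul
  mul_one := Z.mul_unit
  mul_comm := hZ

variable (Z : DaggerFrobenius H)

lemma gate_mul (x y : H) : Z.gate x * Z.gate y = Z.gate (Z.mul (x ⊗ₜ y)) := by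
  ext z
  exact (Z.mul_assoc x y z).symm

lemma gate_pow (hZ : Z.IsCommutative) (x : H) (k : ℕ) :
    letI := Z.commMonoid hZ
    Z.gate x ^ k = Z.gate (x ^ k) := by
  let _ := Z.commMonoid hZ
  induction k with
  | zero =>
    ext z
    exact (Z.unit_mul z).symm
  | succ k ih =>
    rw [pow_succ, pow_succ, ih]
    exact Z.gate_mul _ _

lemma gate_list_prod (hZ : Z.IsCommutative) (l : List H) :
    letI := Z.commMonoid hZ
    (l.map Z.gate).prod = Z.gate l.prod := by
  let _ := Z.commMonoid hZ
  induction l with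
  | nil =>
    ext z
    exact (Z.unit_mul z).symm
  | cons a l ih =>
    rw [List.map_cons, List.prod_cons, List.prod_cons, ih]
    exact Z.gate_mul _ _

lemma prod_gate_pow_unit (hZ : Z.IsCommutative) {M : ℕ} (x : Fin M → H) (k : Fin M → ℕ) :
    letI := Z.commMonoid hZ
    (List.ofFn fun r => Z.gate (x r) ^ k r).prod Z.unit = ∏ r, x r ^ k r := by
  let _ := Z.commMonoid hZ
  have h : (List.ofFn fun r => Z.gate (x r) ^ k r) =
      (List.ofFn fun r => x r ^ k r).map Z.gate := by
    rw [List.map_ofFn]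
    congr 1
    funext r
    exact Z.gate_pow hZ _ _
  rw [h, Z.gate_list_prod hZ, List.prod_ofFn]
  exact Z.mul_unit _

lemma inner_comul (t : H ⊗[ℂ] H) (y : H) : ⟪t, Z.comul y⟫_ℂ = ⟪Z.mul t, y⟫_ℂ :=
  LinearMap.adjoint_inner_right _ _ _

lemma rTensor_gate_comul (x y : H) :
    (Z.gate x).rTensor H (Z.comul y) = Z.comul (Z.mul (x ⊗ₜ y)) := by
  have h := LinearMap.congr_fun Z.frobenius_left (x ⊗ₜ y)
  simp only [LinearMap.comp_apply, LinearMap.lTensor_tmul, LinearEquiv.coe_coe] at h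
  change _ = LinearMap.adjoint Z.mul (Z.mul (x ⊗ₜ y))
  rw [← h, comul]
  induction LinearMap.adjoint Z.mul y using TensorProduct.induction_on with
  | zero => simp
  | tmul a b => simp [gate]
  | add a b ha hb => simp only [map_add, TensorProduct.tmul_add, ha, hb]

lemma lTensor_gate_comul (hZ : Z.IsCommutative) (x y : H) :
    (Z.gate x).lTensor H (Z.comul y) = Z.comul (Z.mul (x ⊗ₜ y)) := by
  have h := LinearMap.congr_fun Z.frobenius_right (y ⊗ₜ x)
  simp only [LinearMap.comp_apply, LinearMap.rTensor_tmul, LinearEquiv.coe_coe] at h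
  rw [hZ x y]
  change _ = LinearMap.adjoint Z.mul (Z.mul (y ⊗ₜ x))
  rw [← h, comul]
  induction LinearMap.adjoint Z.mul y using TensorProduct.induction_on with
  | zero => simp
  | tmul a b => simp [gate, hZ x b]
  | add a b ha hb => simp only [map_add, TensorProduct.add_tmul, ha, hb]

lemma map_gate_comul (hZ : Z.IsCommutative) (x y z : H) :
    TensorProduct.map (Z.gate x) (Z.gate y) (Z.comul z) =
      Z.comul (Z.mul (Z.mul (x ⊗ₜ y) ⊗ₜ z)) := by
  have h : TensorProduct.map (Z.gate x) (Z.gate y) =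
      (Z.gate x).rTensor H ∘ₗ (Z.gate y).lTensor H := by
    ext; simp
  rw [h, LinearMap.comp_apply, Z.lTensor_gate_comul hZ, Z.rTensor_gate_comul, Z.mul_assoc]

end DaggerFrobenius

lemma bra_tprod {H : Type v} [NormedAddCommGroup H] [InnerProductSpace ℂ H] {N : ℕ}
    (x y : Fin N → H) : bra x (PiTensorProduct.tprod ℂ y) = ∏ j, ⟪x j, y j⟫_ℂ := by
  simp [bra]

lemma bra_map_mulEquiv {H : Type v} [NormedAddCommGroup H] [InnerProductSpace ℂ H] {N : ℕ}
    (x : Fin (N + 1) → H) (G : Fin (N + 1) → H →ₗ[ℂ] H) (a : ⨂[ℂ]^N H) (b : H) :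
    bra x (PiTensorProduct.map G (TensorPower.mulEquiv (a ⊗ₜ[ℂ]
      (PiTensorProduct.subsingletonEquiv (R := ℂ) (s := fun _ : Fin 1 => H) (0 : Fin 1)).symm b))) =
    bra (fun j => x j.castSucc) (PiTensorProduct.map (fun j => G j.castSucc) a) *
      ⟪x (Fin.last N), G (Fin.last N) b⟫_ℂ := by
  induction a using PiTensorProduct.induction_on with
  | smul_tprod r f =>
    have hb : (PiTensorProduct.subsingletonEquiv (R := ℂ) (s := fun _ : Fin 1 => H)
        (0 : Fin 1)).symm b = PiTensorProduct.tprod ℂ (fun _ => b) := by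
      rw [LinearEquiv.symm_apply_eq, PiTensorProduct.subsingletonEquiv_apply_tprod]
    have hm : TensorPower.mulEquiv (PiTensorProduct.tprod ℂ f ⊗ₜ[ℂ]
        PiTensorProduct.tprod ℂ (fun _ : Fin 1 => b)) =
        PiTensorProduct.tprod ℂ (Fin.append f (fun _ => b)) :=
      TensorPower.tprod_mul_tprod ℂ f (fun _ => b)
    rw [hb, ← TensorProduct.smul_tmul', map_smul, map_smul, map_smul, hm,
      PiTensorProduct.map_tprod, bra_tprod, map_smul, map_smul, PiTensorProduct.map_tprod,
      bra_tprod, Fin.prod_univ_castSucc, smul_mul_assoc]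
    congr 2
    · refine Finset.prod_congr rfl fun j _ => ?_
      rw [show j.castSucc = Fin.castAdd 1 j from rfl, Fin.append_left]
    · rw [show Fin.last N = Fin.natAdd N (0 : Fin 1) from rfl, Fin.append_right]
  | add a a' ha ha' => simp only [TensorProduct.add_tmul, map_add, ha, ha', add_mul]

namespace DaggerFrobenius

variable {H : Type v} [NormedAddCommGroup H] [InnerProductSpace ℂ H] [FiniteDimensional ℂ H]
variable (Z : DaggerFrobenius H)

/-- Amplitudes of a generalised GHZ state after local phase gates. -/
lemma bra_map_gate_copies (hZ : Z.IsCommutative) (N : ℕ) (x y : Fin N → H) (z : H) :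
    letI := Z.commMonoid hZ
    bra x (PiTensorProduct.map (fun j => Z.gate (y j)) (Z.copies N z)) =
      ⟪∏ j, x j, (∏ j, y j) * z⟫_ℂ := by
  let _ := Z.commMonoid hZ
  induction N generalizing z with
  | zero =>
    have h : (PiTensorProduct.isEmptyEquiv (R := ℂ) (s := fun _ : Fin 0 => H) (Fin 0)).symm
        (Z.counit z) = Z.counit z • PiTensorProduct.tprod ℂ (fun i : Fin 0 => i.elim0) := by
      rw [LinearEquiv.symm_apply_eq, map_smul, PiTensorProduct.isEmptyEquiv_apply_tprod]
      simp
    rw [copies, LinearMap.comp_apply, LinearEquiv.coe_coe, h, map_smul, map_smul,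
      PiTensorProduct.map_tprod, bra_tprod]
    simp only [Finset.univ_eq_empty, Finset.prod_empty, smul_eq_mul, one_mul]
    exact mul_one _
  | succ N ih =>
    set T : H ⊗[ℂ] H →ₗ[ℂ] ℂ :=
      bra x ∘ₗ PiTensorProduct.map (fun j => Z.gate (y j)) ∘ₗ
        TensorPower.mulEquiv.toLinearMap ∘ₗ TensorProduct.map (Z.copies N)
          (PiTensorProduct.subsingletonEquiv (R := ℂ) (s := fun _ : Fin 1 => H)
            (0 : Fin 1)).symm.toLinearMap with hT
    have key : T = (innerₛₗ ℂ ((∏ j : Fin N, x j.castSucc) ⊗ₜ[ℂ] x (Fin.last N)) :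
        H ⊗[ℂ] H →ₗ[ℂ] ℂ) ∘ₗ
        TensorProduct.map (Z.gate (∏ j : Fin N, y j.castSucc)) (Z.gate (y (Fin.last N))) := by
      refine TensorProduct.ext' fun p q => ?_
      simp only [hT, LinearMap.comp_apply, TensorProduct.map_tmul, LinearEquiv.coe_coe,
        innerₛₗ_apply_apply, TensorProduct.inner_tmul]
      rw [bra_map_mulEquiv, ih]
      rfl
    have h : bra x (PiTensorProduct.map (fun j => Z.gate (y j)) (Z.copies (N + 1) z)) =
      T (Z.comul z) := rfl
    rw [h, key, LinearMap.comp_apply, Z.map_gate_comul hZ, innerₛₗ_apply_apply, inner_comul,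
      Fin.prod_univ_castSucc, Fin.prod_univ_castSucc]
    rfl

/-! ## Classical states -/

lemma IsClassical.mul_self {X : DaggerFrobenius H} (hX : X.IsSpecial) {ψ : H}
    (h : X.IsClassical ψ) : X.mul (ψ ⊗ₜ ψ) = ψ := by
  rw [← h.1]
  exact LinearMap.congr_fun hX ψ

lemma IsClassical.inner_self {X : DaggerFrobenius H} (hX : X.IsSpecial) {ψ : H}
    (h : X.IsClassical ψ) : ⟪ψ, ψ⟫_ℂ = 1 := by
  rw [← h.2.1, h.mul_self hX, h.2.2]

lemma IsClassical.inner_eq_zero {X : DaggerFrobenius H} (hX : X.IsSpecial) {ψ φ : H}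
    (h : X.IsClassical ψ) (h' : X.IsClassical φ) (hne : ψ ≠ φ) : ⟪ψ, φ⟫_ℂ = 0 := by
  have hsq : ⟪ψ, φ⟫_ℂ = ⟪ψ, φ⟫_ℂ * ⟪ψ, φ⟫_ℂ := by
    conv_lhs => rw [← h.mul_self hX, ← inner_comul, h'.1, TensorProduct.inner_tmul]
  by_contra h0
  have h1 : ⟪ψ, φ⟫_ℂ = 1 := (mul_eq_left₀ h0).mp hsq.symm
  apply hne
  rw [← sub_eq_zero, ← inner_self_eq_zero (𝕜 := ℂ)]
  have h2 : ⟪φ, ψ⟫_ℂ = 1 := by rw [← inner_conj_symm, h1, map_one]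
  rw [inner_sub_left, inner_sub_right, inner_sub_right, h1, h2, h.inner_self hX,
    h'.inner_self hX, sub_self]

end DaggerFrobenius

namespace MerminArgument

variable {H : Type v} [NormedAddCommGroup H] [InnerProductSpace ℂ H] [FiniteDimensional ℂ H]
variable {K : Type u} [AddCommGroup K] {S M : ℕ} {𝒮 : IntSystem K S M} {N : ℕ}
variable (A : MerminArgument H 𝒮 N)

lemma inner_label [DecidableEq K] (g h : K) :
    ⟪(A.label g : H), (A.label h : H)⟫_ℂ = if g = h then 1 else 0 := by
  split_ifs with hgh
  · rw [hgh]
    exact (A.label h).2.inner_self A.X_special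
  · refine (A.label g).2.inner_eq_zero A.X_special (A.label h).2 fun he => hgh ?_
    exact A.label.injective (Subtype.ext he)

lemma prod_label (g : Fin N → K) :
    letI := A.Z.commMonoid A.Z_comm
    ∏ j, (A.label (g j) : H) = A.label (∑ j, g j) := by
  let _ := A.Z.commMonoid A.Z_comm
  let f : Multiplicative K →* H :=
    { toFun := fun k => (A.label k.toAdd : H)
      map_one' := A.label_zero
      map_mul' := fun g h => A.label_add g.toAdd h.toAdd }
  have := map_prod f (fun j => Multiplicative.ofAdd (g j)) Finset.univ
  rw [← ofAdd_sum] at this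
  exact this.symm

/-- If the phases of a joint choice multiply to the classical state of `a`, up to a global phase,
then its outcomes are uniformly distributed among those of sum `a`. -/
lemma born_eq [DecidableEq K] {m : Fin N → Fin (M + 1)} {z : ℂ} (hz : ‖z‖ = 1) {a : K}
    (h : letI := A.Z.commMonoid A.Z_comm; ∏ j, A.phase (m j) = z • (A.label a : H))
    (g : Fin N → K) :
    A.born m g = if ∑ j, g j = a then ((Nat.card K : ℝ≥0) ^ (N - 1))⁻¹ else 0 := by
  let _ := A.Z.commMonoid A.Z_comm
  have hamp : bra (fun j => (A.label (g j) : H)) (A.state m) =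
      if ∑ j, g j = a then z else 0 := by
    rw [state, DaggerFrobenius.ghz, A.Z.bra_map_gate_copies A.Z_comm, A.prod_label, h]
    change ⟪_, A.Z.mul (_ ⊗ₜ A.Z.unit)⟫_ℂ = _
    rw [A.Z.mul_unit, inner_smul_right, A.inner_label]
    simp
  rw [born, hamp]
  have hz' : ‖z‖₊ = 1 := NNReal.eq hz
  split_ifs <;> simp [hz']

end MerminArgument

/-! ## Uniform distributions on outcomes of prescribed sum -/

section SumDist

open Classical in
lemma card_filter_sum_eq {ι K : Type*} [Fintype ι] [Nonempty ι] [AddCommGroup K] [Fintype K]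
    (a : K) :
    (Finset.univ.filter fun o : ι → K => ∑ i, o i = a).card =
      Fintype.card K ^ (Fintype.card ι - 1) := by
  obtain ⟨i₀⟩ := ‹Nonempty ι›
  have hconst : ∀ b : K, (Finset.univ.filter fun o : ι → K => ∑ i, o i = b).card =
      (Finset.univ.filter fun o : ι → K => ∑ i, o i = a).card := fun b => by
    refine Finset.card_equiv (Equiv.addRight (Pi.single i₀ (a - b))) fun o => ?_
    simp only [Finset.mem_filter, Finset.mem_univ, true_and, Equiv.coe_addRight, Pi.add_apply,
      Finset.sum_add_distrib, Finset.sum_pi_single', if_true]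
    constructor
    · rintro rfl; abel
    · intro h; rw [← sub_eq_zero] at h ⊢; rw [← h]; abel
  have htot : (Finset.univ : Finset (ι → K)).card =
      ∑ b : K, (Finset.univ.filter fun o : ι → K => ∑ i, o i = b).card :=
    Finset.card_eq_sum_card_fiberwise fun _ _ => Finset.mem_univ _
  simp only [hconst, Finset.sum_const, Finset.card_univ, smul_eq_mul, Fintype.card_pi,
    Finset.prod_const] at htot
  have hpos : 0 < Fintype.card K := Fintype.card_pos_iff.mpr ⟨0⟩
  have hι : Fintype.card ι = (Fintype.card ι - 1) + 1 :=
    (Nat.succ_pred_eq_of_pos (Fintype.card_pos_iff.mpr ⟨i₀⟩)).symm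
  rw [hι, pow_succ, mul_comm] at htot
  exact (Nat.eq_of_mul_eq_mul_left hpos htot).symm

open Classical in
/-- The uniform distribution on the families of group elements of sum `a`. -/
def sumDist {ι K : Type*} [Fintype ι] [Nonempty ι] [AddCommGroup K] [Finite K] (a : K) :
    RDist ℝ≥0 (ι → K) where
  wt := Finsupp.equivFunOnFinite.symm fun o =>
    if ∑ i, o i = a then ((Nat.card K : ℝ≥0) ^ (Fintype.card ι - 1))⁻¹ else 0
  total := by
    have : Fintype K := Fintype.ofFinite K
    rw [Finsupp.sum_fintype _ _ (fun _ => rfl)]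
    simp only [Finsupp.equivFunOnFinite_symm_apply_apply]
    rw [← Finset.sum_filter, Finset.sum_const, card_filter_sum_eq, nsmul_eq_mul,
      Nat.card_eq_fintype_card, Nat.cast_pow, mul_inv_cancel₀]
    exact pow_ne_zero _ (Nat.cast_ne_zero.mpr Fintype.card_ne_zero)

open Classical in
lemma sumDist_wt {ι K : Type*} [Fintype ι] [Nonempty ι] [AddCommGroup K] [Finite K] (a : K)
    (o : ι → K) : (sumDist a).wt o =
      if ∑ i, o i = a then ((Nat.card K : ℝ≥0) ^ (Fintype.card ι - 1))⁻¹ else 0 := rfl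

@[ext] lemma RDist.ext {R : Type*} [CommSemiring R] {U : Type*} {d d' : RDist R U}
    (h : d.wt = d'.wt) : d = d' := by
  cases d; cases d'; congr

/-- On a finite set there is only one distribution with constant weights. -/
lemma RDist.eq_of_const {U : Type*} [Finite U] {d d' : RDist ℝ≥0 U}
    (h : ∀ x y, d.wt x = d.wt y) (h' : ∀ x y, d'.wt x = d'.wt y) : d = d' := by
  have : Fintype U := Fintype.ofFinite U
  ext1
  ext1 x
  have h1 := d.total
  have h2 := d'.total
  rw [Finsupp.sum_fintype _ _ (fun _ => rfl)] at h1 h2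
  simp only [h _ x, h' _ x, Finset.sum_const, nsmul_eq_mul] at h1 h2
  have hc : ((Finset.univ : Finset U).card : ℝ≥0) ≠ 0 := fun h0 => by
    rw [h0, zero_mul] at h1
    exact zero_ne_one h1
  exact mul_left_cancel₀ hc (h1.trans h2.symm)

/-- The marginals of `sumDist` on proper subsets are uniform. -/
lemma sumDist_map_restrict_const {X K : Type*} [AddCommGroup K] [Finite K] {V U : Finset X}
    [Nonempty U] (hVU : V ⊆ U) (hne : V ≠ U) (a : K) (t t' : V → K) :
    ((sumDist (ι := U) a).map (restrict K hVU)).wt t =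
      ((sumDist (ι := U) a).map (restrict K hVU)).wt t' := by
  classical
  have : Fintype K := Fintype.ofFinite K
  obtain ⟨x₀, hx₀U, hx₀V⟩ := Finset.exists_of_ssubset (hVU.ssubset_of_ne hne)
  set e : U → K := fun x => if h : x.1 ∈ V then (t' - t) ⟨x.1, h⟩ else 0 with he
  set d : U → K := e - Pi.single ⟨x₀, hx₀U⟩ (∑ i, e i) with hd
  have hdsum : ∑ i, d i = 0 := by
    simp [hd, Finset.sum_sub_distrib]
  have hdV : restrict K hVU d = t' - t := by
    funext x
    have hx : (⟨x.1, hVU x.2⟩ : U) ≠ ⟨x₀, hx₀U⟩ := fun h => by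
      have h' : x.1 = x₀ := congrArg Subtype.val h
      exact hx₀V (h' ▸ x.2)
    simp [restrict, hd, he, Pi.single_eq_of_ne hx]
  have hwt : ∀ s : V → K, ((sumDist (ι := U) a).map (restrict K hVU)).wt s =
      ∑ o : U → K, if restrict K hVU o = s then (sumDist (ι := U) a).wt o else 0 := by
    intro s
    change (Finsupp.mapDomain _ _) s = _
    rw [Finsupp.mapDomain, Finsupp.sum_fintype _ _ (fun _ => Finsupp.single_zero _),
      Finsupp.finsetSum_apply]
    simp only [Finsupp.single_apply]
  rw [hwt, hwt]
  refine Fintype.sum_equiv (Equiv.addRight d) _ _ fun o => ?_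
  have h1 : restrict K hVU (o + d) = restrict K hVU o + (t' - t) := by rw [← hdV]; rfl
  have h2 : (sumDist (ι := U) a).wt (o + d) = (sumDist (ι := U) a).wt o := by
    simp only [sumDist_wt, Pi.add_apply, Finset.sum_add_distrib, hdsum, add_zero]
  simp only [Equiv.coe_addRight, h1, h2]
  congr 1
  rw [← eq_sub_iff_add_eq, sub_sub_cancel]

end SumDist

/-! ## Joint choices -/

section Choices

/-- The blocks into which `{0, …, N - 1}` is cut by consecutive lengths `p 0, …, p M`. -/
lemma sup_filter_eq_iff {M N : ℕ} (p : Fin (M + 1) → ℕ) (hp : ∑ r, p r = N) {j : ℕ} (hj : j < N)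
    (m : Fin (M + 1)) :
    (Finset.univ.filter fun m : Fin (M + 1) =>
      ∑ r ∈ Finset.univ.filter (· < m), p r ≤ j).sup id = m ↔
      ∑ r ∈ Finset.univ.filter (· < m), p r ≤ j ∧
        j < ∑ r ∈ Finset.univ.filter (· < m), p r + p m := by
  have hle : ∀ m : Fin (M + 1), ∑ r ∈ Finset.univ.filter (· < m), p r + p m =
      ∑ r ∈ Finset.univ.filter (· ≤ m), p r := fun m => by
    have : (Finset.univ.filter (· ≤ m) : Finset (Fin (M + 1))) =
        insert m (Finset.univ.filter (· < m)) := by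
      ext r; simp [le_iff_lt_or_eq, or_comm]
    rw [this, Finset.sum_insert (by simp), add_comm]
  constructor
  · intro h
    have hmem : m ∈ Finset.univ.filter fun m : Fin (M + 1) =>
        ∑ r ∈ Finset.univ.filter (· < m), p r ≤ j := by
      obtain ⟨m', hm', he⟩ := Finset.exists_mem_eq_sup
        (Finset.univ.filter fun m : Fin (M + 1) => ∑ r ∈ Finset.univ.filter (· < m), p r ≤ j)
        ⟨0, by simp⟩ id
      rw [h] at he
      exact he ▸ hm'
    refine ⟨(Finset.mem_filter.mp hmem).2, ?_⟩
    by_contra hlt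
    rw [not_lt, hle] at hlt
    rcases Fin.eq_castSucc_or_eq_last m with ⟨i, rfl⟩ | rfl
    · have hs : (Finset.univ.filter (· < i.succ) : Finset (Fin (M + 1))) =
          Finset.univ.filter (· ≤ i.castSucc) := by
        ext r; simp [Fin.lt_def, Fin.le_def]
      have : i.succ ≤ i.castSucc := by
        rw [← h]
        exact Finset.le_sup (f := id) (Finset.mem_filter.mpr ⟨Finset.mem_univ _, hs ▸ hlt⟩)
      exact absurd this (not_le.mpr i.castSucc_lt_succ)
    · have hs : (Finset.univ.filter (· ≤ Fin.last M) : Finset (Fin (M + 1))) = Finset.univ := by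
        ext r; simp [Fin.le_last]
      rw [hs, hp] at hlt
      omega
  · rintro ⟨h1, h2⟩
    refine le_antisymm (Finset.sup_le fun m' hm' => ?_)
      (Finset.le_sup (f := id) (Finset.mem_filter.mpr ⟨Finset.mem_univ _, h1⟩))
    by_contra hlt
    rw [id, not_le] at hlt
    rw [hle] at h2
    have hsub : ∑ r ∈ Finset.univ.filter (· ≤ m), p r ≤
        ∑ r ∈ Finset.univ.filter (· < m'), p r :=
      Finset.sum_le_sum_of_subset fun r hr => by
        simp only [Finset.mem_filter, Finset.mem_univ, true_and] at hr ⊢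
        exact hr.trans_lt hlt
    have := (Finset.mem_filter.mp hm').2
    omega

variable {K : Type*} {S M : ℕ} {𝒮 : IntSystem K S M} {N : ℕ}

lemma variation_eq [NeZero N] (s : Fin S) (k j : Fin N) :
    variation 𝒮 N s k j = firstChoice 𝒮 N s (j + k : Fin N) := by
  rw [variation, Fin.val_add]

variable [AddCommGroup K]

lemma sum_padded (h0 : ∀ s r, 0 ≤ 𝒮.coeff s r) (hN : 𝒮.Admissible N) (s : Fin S) :
    ∑ r, padded 𝒮 N s r = N := by
  have h := hN.2.1 s
  have h' : ((∑ r, (𝒮.coeff s r).toNat : ℕ) : ℤ) = ∑ r, 𝒮.coeff s r := by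
    push_cast
    exact Finset.sum_congr rfl fun r _ => Int.toNat_of_nonneg (h0 s r)
  rw [← h'] at h
  have h'' : ∑ r, (𝒮.coeff s r).toNat ≤ N := by exact_mod_cast h
  rw [Fin.sum_univ_succ]
  simp only [padded, Fin.cons_zero, Fin.cons_succ]
  omega

lemma card_firstChoice (h0 : ∀ s r, 0 ≤ 𝒮.coeff s r) (hN : 𝒮.Admissible N) (s : Fin S)
    (m : Fin (M + 1)) :
    (Finset.univ.filter fun j : Fin N => firstChoice 𝒮 N s j = m).card = padded 𝒮 N s m := by
  have hp := sum_padded h0 hN s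
  set P := ∑ r ∈ Finset.univ.filter (· < m), padded 𝒮 N s r with hP
  have hle : P + padded 𝒮 N s m ≤ N := by
    rw [hP, add_comm, ← Finset.sum_insert (by simp : m ∉ Finset.univ.filter (· < m))]
    exact (Finset.sum_le_sum_of_subset (Finset.subset_univ _)).trans hp.le
  have himg : (Finset.univ.filter fun j : Fin N => firstChoice 𝒮 N s j = m).map
      Fin.valEmbedding = Finset.Ico P (P + padded 𝒮 N s m) := by
    ext j
    simp only [Finset.mem_map, Finset.mem_filter, Finset.mem_univ, true_and, Finset.mem_Ico,
      Fin.valEmbedding_apply]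
    constructor
    · rintro ⟨i, hi, rfl⟩
      exact (sup_filter_eq_iff _ hp i.2 m).mp hi
    · intro hj
      have hjN : j < N := by omega
      exact ⟨⟨j, hjN⟩, (sup_filter_eq_iff _ hp hjN m).mpr hj, rfl⟩
  rw [← Finset.card_map Fin.valEmbedding, himg, Nat.card_Ico, Nat.add_sub_cancel_left]

@[to_additive]
lemma prod_firstChoice {β : Type*} [CommMonoid β] (h0 : ∀ s r, 0 ≤ 𝒮.coeff s r)
    (hN : 𝒮.Admissible N) (s : Fin S) (f : Fin (M + 1) → β) :
    ∏ j : Fin N, f (firstChoice 𝒮 N s j) = ∏ r, f r ^ padded 𝒮 N s r := by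
  rw [← Finset.prod_fiberwise' Finset.univ (fun j : Fin N => firstChoice 𝒮 N s j) f]
  refine Finset.prod_congr rfl fun r _ => ?_
  rw [Finset.prod_const, card_firstChoice h0 hN]

lemma prod_variation {β : Type*} [CommMonoid β] (h0 : ∀ s r, 0 ≤ 𝒮.coeff s r)
    (hN : 𝒮.Admissible N) (s : Fin S) (k : Fin N) (f : Fin (M + 1) → β) :
    ∏ j : Fin N, f (variation 𝒮 N s k j) = ∏ r, f r ^ padded 𝒮 N s r := by
  have : NeZero N := ⟨hN.1.ne'⟩
  rw [← prod_firstChoice h0 hN]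
  refine Fintype.prod_equiv (Equiv.addRight k) _ _ fun j => ?_
  rw [variation_eq]
  rfl

lemma sum_sum_variation (h0 : ∀ s r, 0 ≤ 𝒮.coeff s r) (hN : 𝒮.Admissible N) (s : Fin S)
    (f : Fin N → Fin (M + 1) → K) :
    ∑ k, ∑ j, f j (variation 𝒮 N s k j) = ∑ r, padded 𝒮 N s r • ∑ j, f j r := by
  have : NeZero N := ⟨hN.1.ne'⟩
  rw [Finset.sum_comm]
  simp only [Finset.smul_sum]
  rw [Finset.sum_comm (s := Finset.univ (α := Fin (M + 1)))]
  refine Finset.sum_congr rfl fun j _ => ?_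
  rw [← sum_firstChoice h0 hN]
  refine Fintype.sum_equiv (Equiv.addLeft j) _ _ fun k => ?_
  rw [variation_eq]
  rfl

end Choices

/-! ## Contexts and models -/

section Contexts

variable {K : Type u} {S M : ℕ} {𝒮 : IntSystem K S M} {N : ℕ}

lemma meas_injective {m : Fin N → Fin (M + 1)} (hm : m ∈ jointChoices 𝒮 N) :
    Function.Injective (meas hm) := fun _ _ h =>
  congrArg (fun x : Meas 𝒮 N => x.1.1) h

lemma card_context {m : Fin N → Fin (M + 1)} (hm : m ∈ jointChoices 𝒮 N) :
    (context hm).card = N := by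
  rw [context, Finset.card_image_of_injective _ (meas_injective hm), Finset.card_fin]

lemma eq_of_context_eq {m m' : Fin N → Fin (M + 1)} {hm : m ∈ jointChoices 𝒮 N}
    {hm' : m' ∈ jointChoices 𝒮 N} (h : context hm = context hm') : m = m' := by
  funext j
  have hj := meas_mem_context hm j
  rw [h, context, Finset.mem_image] at hj
  obtain ⟨i, -, hi⟩ := hj
  have h1 : i = j := congrArg (fun x : Meas 𝒮 N => x.1.1) hi
  have h2 : m' i = m j := congrArg (fun x : Meas 𝒮 N => x.1.2) hi
  rw [← h2, h1]

lemma sum_context [AddCommGroup K] {m : Fin N → Fin (M + 1)} (hm : m ∈ jointChoices 𝒮 N)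
    (o : context hm → K) :
    ∑ x, o x = ∑ j, o ⟨meas hm j, meas_mem_context hm j⟩ := by
  symm
  refine Fintype.sum_bijective (fun j => (⟨meas hm j, meas_mem_context hm j⟩ : context hm))
    ⟨fun i j h => meas_injective hm (congrArg Subtype.val h), ?_⟩ _ _ fun _ => rfl
  rintro ⟨x, hx⟩
  obtain ⟨j, -, rfl⟩ := Finset.mem_image.mp hx
  exact ⟨j, rfl⟩

/-- Families of uniform distributions on the outcomes of prescribed sums are no-signalling. -/
lemma exists_empiricalModel [AddCommGroup K] [Finite K] [DecidableEq K] (hN : 0 < N)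
    (t : (Fin N → Fin (M + 1)) → K) :
    ∃ ζ : EmpiricalModel (merminScenario 𝒮 N) ℝ≥0 K,
      ∀ (m : Fin N → Fin (M + 1)) (hm : m ∈ jointChoices 𝒮 N) (o : context hm → K),
        (ζ.dist ⟨context hm, m, hm, rfl⟩).wt o =
          if ∑ j, o ⟨meas hm j, meas_mem_context hm j⟩ = t m
          then ((Nat.card K : ℝ≥0) ^ (N - 1))⁻¹ else 0 := by
  classical
  have hcard : ∀ C : (merminScenario 𝒮 N).contexts, C.1.card = N := by
    rintro ⟨_, m, hm, rfl⟩
    exact card_context hm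
  have hne : ∀ C : (merminScenario 𝒮 N).contexts, Nonempty C.1 := fun C => by
    obtain ⟨x, hx⟩ := Finset.card_pos.mp ((hcard C).symm ▸ hN)
    exact ⟨⟨x, hx⟩⟩
  refine ⟨⟨fun C => sumDist (t C.2.choose), fun C C' => ?_⟩, fun m hm o => ?_⟩
  · by_cases h : C = C'
    · subst h; rfl
    · have hC : C.1 ≠ C'.1 := fun h' => h (Subtype.ext h')
      refine RDist.eq_of_const (fun x y => sumDist_map_restrict_const _ (fun he => hC ?_) _ _ _)
        (fun x y => sumDist_map_restrict_const _ (fun he => hC ?_) _ _ _)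
      · exact Finset.eq_of_subset_of_card_le (Finset.inter_eq_left.mp he)
          ((hcard C').trans (hcard C).symm).le
      · exact (Finset.eq_of_subset_of_card_le (Finset.inter_eq_right.mp he)
          ((hcard C).trans (hcard C').symm).le).symm
  · have hch : ∃ (m' : Fin N → Fin (M + 1)) (hm' : m' ∈ jointChoices 𝒮 N),
        context hm = context hm' := ⟨m, hm, rfl⟩
    obtain ⟨hm', he⟩ := hch.choose_spec
    have hm_eq : hch.choose = m := (eq_of_context_eq he).symm
    have : Nonempty (context hm) := hne ⟨context hm, m, hm, rfl⟩
    change (sumDist (t hch.choose)).wt o = _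
    rw [sumDist_wt, hm_eq, sum_context, Fintype.card_coe, card_context]
    congr

/-- A model all of whose possible outcomes have the prescribed sums is All-vs-Nothing, as soon as
no global assignment has these sums. -/
lemma isAvN_of_sum [AddCommGroup K] {ζ : EmpiricalModel (merminScenario 𝒮 N) ℝ≥0 K}
    {t : (Fin N → Fin (M + 1)) → K}
    (hζ : ∀ (m : Fin N → Fin (M + 1)) (hm : m ∈ jointChoices 𝒮 N) (o : context hm → K),
      (ζ.dist ⟨context hm, m, hm, rfl⟩).wt o ≠ 0 →
        ∑ j, o ⟨meas hm j, meas_mem_context hm j⟩ = t m)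
    (ht : ¬ ∃ f : Fin N → Fin (M + 1) → K, ∀ m ∈ jointChoices 𝒮 N, ∑ j, f j (m j) = t m) :
    ζ.collapse.IsAvN ℤ K := by
  classical
  rintro ⟨s, hs⟩
  refine ht ⟨fun j i => if h : ∃ m ∈ jointChoices 𝒮 N, m j = i then s ⟨(j, i), h⟩ else 0,
    fun m hm => ?_⟩
  have hsat := hs (context hm) ⟨m, hm, rfl⟩ ⟨fun _ => 1, t m⟩ fun o ho => ?_
  · simp only [LinEq.SatisfiedBy, one_smul] at hsat
    rw [sum_context hm fun x : context hm => s x] at hsat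
    rw [← hsat]
    refine Finset.sum_congr rfl fun j _ => ?_
    exact dif_pos ⟨m, hm, rfl⟩
  · have h := ho ⟨context hm, m, hm, rfl⟩
    obtain ⟨o', ho', he⟩ := Finset.mem_image.mp (Finsupp.mapDomain_support h)
    have hoo : o' = o := by
      funext x
      exact congrFun he ⟨x.1, Finset.mem_inter.mpr ⟨x.2, x.2⟩⟩
    subst hoo
    simp only [LinEq.SatisfiedBy, one_smul]
    rw [sum_context]
    refine hζ m hm _ ?_
    exact Finsupp.mem_support_iff.mp (Finsupp.support_mapRange (hf := map_zero possHom) ho')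

end Contexts

/-! ## Quantum models are All-vs-Nothing -/

section Main

variable {K : Type u} [AddCommGroup K] {S M : ℕ} {𝒮 : IntSystem K S M} {N : ℕ}

/-- A global assignment for the control and the variations yields a solution of the system. -/
lemma solvable_of_assignment (h0 : ∀ s r, 0 ≤ 𝒮.coeff s r) (hN : 𝒮.Admissible N)
    (f : Fin N → Fin (M + 1) → K) (hc : ∑ j, f j 0 = 0)
    (hv : ∀ s k, ∑ j, f j (variation 𝒮 N s k j) = 𝒮.rhs s) : 𝒮.Solvable := by
  have hNs : ∀ s, ∑ r, 𝒮.coeff s r • ∑ j, f j (Fin.succ r) = N • 𝒮.rhs s := fun s => by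
    have h := sum_sum_variation h0 hN s f
    simp only [hv, Finset.sum_const, Finset.card_fin] at h
    rw [h, Fin.sum_univ_succ, hc, smul_zero, zero_add]
    refine Finset.sum_congr rfl fun r _ => ?_
    rw [padded, Fin.cons_succ, ← natCast_zsmul, Int.toNat_of_nonneg (h0 s r)]
  obtain ⟨u, hu⟩ : ∃ u : ℤ, ∀ x : K, u • (N • x) = x := by
    have hbez := Nat.gcd_eq_gcd_ab N (AddMonoid.exponent K)
    refine ⟨Nat.gcdA N (AddMonoid.exponent K), fun x => ?_⟩
    rw [hN.2.2.gcd_eq_one] at hbez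
    conv_rhs => rw [← one_zsmul x, ← Nat.cast_one, hbez, add_zsmul, mul_comm, mul_zsmul,
      mul_comm, mul_zsmul, natCast_zsmul, natCast_zsmul, AddMonoid.exponent_nsmul_eq_zero]
    simp
  refine ⟨fun r => u • ∑ j, f j (Fin.succ r), fun s => ?_⟩
  rw [← hu (𝒮.rhs s), ← hNs, Finset.smul_sum]
  exact Finset.sum_congr rfl fun r _ => smul_comm _ _ _

namespace MerminArgument

variable {H : Type v} [NormedAddCommGroup H] [InnerProductSpace ℂ H] [FiniteDimensional ℂ H]
variable (A : MerminArgument H 𝒮 N)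

lemma prod_phase_control :
    letI := A.Z.commMonoid A.Z_comm
    ∏ _j : Fin N, A.phase 0 = (1 : ℂ) • (A.label 0 : H) := by
  let _ := A.Z.commMonoid A.Z_comm
  rw [one_smul, A.label_zero]
  exact Finset.prod_eq_one fun _ _ => rfl

lemma exists_prod_phase_variation (s : Fin S) (k : Fin N) :
    letI := A.Z.commMonoid A.Z_comm
    ∃ z : ℂ, ‖z‖ = 1 ∧ ∏ j, A.phase (variation 𝒮 N s k j) = z • (A.label (𝒮.rhs s) : H) := by
  let _ := A.Z.commMonoid A.Z_comm
  obtain ⟨z, hz, h⟩ := A.β_solution s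
  refine ⟨z, hz, ?_⟩
  rw [prod_variation A.coeff_nonneg A.admissible, Fin.prod_univ_succ, ← h,
    A.Z.prod_gate_pow_unit A.Z_comm]
  have h1 : A.phase 0 = 1 := rfl
  rw [h1, one_pow, one_mul]
  rfl

theorem exists_realises_isAvN [Finite K] (h : ¬ 𝒮.Solvable) :
    ∃ ζ : EmpiricalModel (merminScenario 𝒮 N) ℝ≥0 K, A.Realises ζ ∧ ζ.collapse.IsAvN ℤ K := by
  classical
  let _ := A.Z.commMonoid A.Z_comm
  have hex : ∀ m : Fin N → Fin (M + 1), m ∈ jointChoices 𝒮 N → ∃ a : K, ∃ z : ℂ, ‖z‖ = 1 ∧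
      ∏ j, A.phase (m j) = z • (A.label a : H) := by
    rintro m (rfl | ⟨s, k, rfl⟩)
    · exact ⟨0, 1, norm_one, A.prod_phase_control⟩
    · exact ⟨𝒮.rhs s, A.exists_prod_phase_variation s k⟩
  have huniq : ∀ {a b : K} {y z : ℂ}, ‖y‖ = 1 → y • (A.label a : H) = z • (A.label b : H) →
      a = b := by
    intro a b y z hy he
    by_contra hab
    have := congrArg (fun v : H => ⟪(A.label a : H), v⟫_ℂ) he
    simp only [inner_smul_right, A.inner_label, if_neg hab, if_true, mul_one, mul_zero] at this
    simp [this] at hy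
  let t : (Fin N → Fin (M + 1)) → K := fun m =>
    if hm : m ∈ jointChoices 𝒮 N then (hex m hm).choose else 0
  have ht : ∀ m ∈ jointChoices 𝒮 N, ∃ z : ℂ, ‖z‖ = 1 ∧
      ∏ j, A.phase (m j) = z • (A.label (t m) : H) := fun m hm => by
    simp only [t, dif_pos hm]
    exact (hex m hm).choose_spec
  obtain ⟨ζ, hζ⟩ := exists_empiricalModel (𝒮 := 𝒮) A.admissible.1 t
  refine ⟨ζ, fun m hm o => ?_, isAvN_of_sum (t := t) (fun m hm o ho => ?_) ?_⟩
  · obtain ⟨z, hz, he⟩ := ht m hm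
    rw [hζ, A.born_eq hz he]
  · rw [hζ] at ho
    by_contra hne
    exact ho (if_neg hne)
  · rintro ⟨f, hf⟩
    refine h (solvable_of_assignment A.coeff_nonneg A.admissible f ?_ fun s k => ?_)
    · have hm : (fun _ => 0 : Fin N → Fin (M + 1)) ∈ jointChoices 𝒮 N := Or.inl rfl
      rw [hf _ hm]
      obtain ⟨z, hz, he⟩ := ht _ hm
      exact huniq hz (he.symm.trans A.prod_phase_control)
    · have hm : variation 𝒮 N s k ∈ jointChoices 𝒮 N := Or.inr ⟨s, k, rfl⟩
      rw [hf _ hm]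
      obtain ⟨z, hz, he⟩ := ht _ hm
      obtain ⟨z', hz', he'⟩ := A.exists_prod_phase_variation s k
      exact huniq hz (he.symm.trans he')

end MerminArgument

end Main

/-! ## Integer equations and equations modulo `n` -/

section ZModEquations

variable {X G : Type*} [AddCommGroup G]

lemma LinEq.satisfiedBy_intCast {C : Finset X} (n : ℕ) [Module (ZMod n) G] (φ : LinEq ℤ G C)
    (s : C → G) :
    (⟨fun x => (φ.coeff x : ZMod n), φ.rhs⟩ : LinEq (ZMod n) G C).SatisfiedBy s ↔
      φ.SatisfiedBy s := by
  simp only [LinEq.SatisfiedBy, Int.cast_smul_eq_zsmul]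

lemma isAvN_int_iff_zmod [DecidableEq X] {𝒮c : Scenario X} (ζ : EmpiricalModel 𝒮c Poss G) (n : ℕ)
    [Module (ZMod n) G] : ζ.IsAvN ℤ G ↔ ζ.IsAvN (ZMod n) G := by
  refine not_congr (exists_congr fun s => forall₂_congr fun C _ => ⟨fun h φ hφ => ?_,
    fun h φ hφ => ?_⟩)
  · have hlift : (⟨fun x => (((φ.coeff x).cast : ℤ) : ZMod n), φ.rhs⟩ : LinEq (ZMod n) G C) = φ := by
      simp only [ZMod.intCast_zmod_cast]
    have key := LinEq.satisfiedBy_intCast n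
      (⟨fun x => ((φ.coeff x).cast : ℤ), φ.rhs⟩ : LinEq ℤ G C)
    simp only [hlift] at key
    rw [key]
    exact h _ fun o ho => (key o).mp (hφ o ho)
  · rw [← LinEq.satisfiedBy_intCast n]
    exact h _ fun o ho => (LinEq.satisfiedBy_intCast n φ o).mpr (hφ o ho)

end ZModEquations

/-! ## Consistent systems -/

namespace IntSystem

variable {K : Type*} [AddCommGroup K] {S M : ℕ} {𝒮 : IntSystem K S M}

/-- Consistent systems are solvable in every divisible group. -/
lemma Consistent.exists_solution_of_divisible (h : 𝒮.Consistent) {Q : Type*} [AddCommGroup Q]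
    [DivisibleBy Q ℤ] (f : K →+ Q) :
    ∃ y : Fin M → Q, ∀ s, ∑ r, 𝒮.coeff s r • y r = f (𝒮.rhs s) := by
  let A : (Fin S → ℤ) →ₗ[ℤ] (Fin M → ℤ) := Fintype.linearCombination ℤ 𝒮.coeff
  let b : (Fin S → ℤ) →ₗ[ℤ] Q := Fintype.linearCombination ℤ fun s => f (𝒮.rhs s)
  have hker : LinearMap.ker A ≤ LinearMap.ker b := fun c hc => by
    rw [LinearMap.mem_ker] at hc ⊢
    have hrel := h c fun r => by
      simpa [A, Fintype.linearCombination_apply] using congrFun hc r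
    simpa [b, Fintype.linearCombination_apply] using congrArg f hrel
  obtain ⟨e, he⟩ := (Module.Baer.of_divisible Q).extension_property (LinearMap.range A).subtype
    (Submodule.subtype_injective _)
    ((LinearMap.ker A).liftQ b hker ∘ₗ A.quotKerEquivRange.symm.toLinearMap)
  refine ⟨fun r => e (Pi.single r 1), fun s => ?_⟩
  have h1 := LinearMap.congr_fun he ⟨A (Pi.single s 1), LinearMap.mem_range_self _ _⟩
  have h2 : A (Pi.single s 1) = 𝒮.coeff s := by
    simp [A]
  have h3 : b (Pi.single s 1) = f (𝒮.rhs s) := by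
    simp [b]
  have h4 : A.quotKerEquivRange.symm ⟨A (Pi.single s 1), LinearMap.mem_range_self _ _⟩ =
      (LinearMap.ker A).mkQ (Pi.single s 1) := by
    rw [LinearEquiv.symm_apply_eq]
    rfl
  change e (A (Pi.single s 1)) = (LinearMap.ker A).liftQ b hker (A.quotKerEquivRange.symm _) at h1
  rw [h4, Submodule.mkQ_apply, Submodule.liftQ_apply, h2, h3] at h1
  rw [← h1]
  conv_rhs => rw [pi_eq_sum_univ' (𝒮.coeff s), map_sum]
  refine Finset.sum_congr rfl fun r _ => ?_
  rw [map_smul]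

lemma exists_pos_nsmul_eq_zero (y : AddCircle (1 : ℚ)) : ∃ n : ℕ, 0 < n ∧ n • y = 0 := by
  induction y using QuotientAddGroup.induction_on with
  | H q =>
    refine ⟨q.den, q.den_pos, ?_⟩
    rw [← QuotientAddGroup.mk_nsmul, nsmul_eq_mul, mul_comm, Rat.mul_den_eq_num,
      QuotientAddGroup.eq_zero_iff]
    exact ⟨q.num, by simp⟩

/-- Consistency is stable under changes of the coefficients by multiples of a suitable integer. -/
lemma Consistent.exists_modulus [Finite K] (h : 𝒮.Consistent) :
    ∃ L : ℕ, 0 < L ∧ ∀ 𝒮' : IntSystem K S M, 𝒮'.rhs = 𝒮.rhs →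
      (∀ s r, (L : ℤ) ∣ 𝒮'.coeff s r - 𝒮.coeff s r) → 𝒮'.Consistent := by
  have : Fintype K := Fintype.ofFinite K
  have hchar : ∀ k : K, ∃ ψ : K →+ AddCircle (1 : ℚ), ψ k = 0 → k = 0 := fun k => by
    by_cases hk : k = 0
    · exact ⟨0, fun _ => hk⟩
    · obtain ⟨ψ, hψ⟩ := CharacterModule.exists_character_apply_ne_zero_of_ne_zero hk
      exact ⟨ψ, fun h => absurd h hψ⟩
  choose ψ hψ using hchar
  choose y hy using fun k => h.exists_solution_of_divisible (ψ k)
  choose n hn hny using fun k r => exists_pos_nsmul_eq_zero (y k r)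
  refine ⟨∏ k, ∏ r, n k r, Finset.prod_pos fun k _ => Finset.prod_pos fun r _ => hn k r,
    fun 𝒮' hrhs hdvd c hc => hψ _ ?_⟩
  set k := ∑ s, c s • 𝒮'.rhs s
  have hzero : ∀ s r, (𝒮'.coeff s r - 𝒮.coeff s r) • y k r = 0 := fun s r => by
    have hd : (n k r : ℤ) ∣ 𝒮'.coeff s r - 𝒮.coeff s r := by
      refine (Int.natCast_dvd_natCast.mpr ?_).trans (hdvd s r)
      exact (Finset.dvd_prod_of_mem (n k) (Finset.mem_univ r)).trans
        (Finset.dvd_prod_of_mem (fun k => ∏ r, n k r) (Finset.mem_univ k))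
    obtain ⟨d, hd⟩ := hd
    rw [hd, mul_comm, mul_zsmul, natCast_zsmul, hny, smul_zero]
  have hsol : ∀ s, ψ k (𝒮'.rhs s) = ∑ r, 𝒮'.coeff s r • y k r := fun s => by
    rw [hrhs, ← hy]
    refine Finset.sum_congr rfl fun r _ => ?_
    rw [eq_comm, ← sub_eq_zero, ← sub_smul, hzero]
  rw [map_sum]
  simp only [map_zsmul, hsol, Finset.smul_sum, ← mul_zsmul]
  rw [Finset.sum_comm]
  refine Finset.sum_eq_zero fun r _ => ?_
  rw [← Finset.sum_smul, hc, zero_smul]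

lemma Solvable.of_modEq {𝒮' : IntSystem K S M} (hrhs : 𝒮'.rhs = 𝒮.rhs)
    (h : ∀ s r, 𝒮'.coeff s r ≡ 𝒮.coeff s r [ZMOD (AddMonoid.exponent K : ℤ)])
    (hs : 𝒮'.Solvable) : 𝒮.Solvable := by
  obtain ⟨y, hy⟩ := hs
  refine ⟨y, fun s => ?_⟩
  rw [← hrhs, ← hy]
  refine Finset.sum_congr rfl fun r _ => ?_
  obtain ⟨d, hd⟩ := (h s r).dvd
  rw [← sub_eq_zero, ← sub_smul, hd, mul_comm, mul_zsmul, natCast_zsmul,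
    AddMonoid.exponent_nsmul_eq_zero, smul_zero]

/-- Consistent systems may be given nonnegative coefficients. -/
lemma Consistent.exists_nonneg [Finite K] (h : 𝒮.Consistent) :
    ∃ 𝒮' : IntSystem K S M, 𝒮'.rhs = 𝒮.rhs ∧ (∀ s r, 0 ≤ 𝒮'.coeff s r) ∧
      (∀ s r, 𝒮'.coeff s r ≡ 𝒮.coeff s r [ZMOD (AddMonoid.exponent K : ℤ)]) ∧
      ((∀ s r, 0 ≤ 𝒮.coeff s r) → 𝒮' = 𝒮) ∧ 𝒮'.Consistent := by
  by_cases h0 : ∀ s r, 0 ≤ 𝒮.coeff s r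
  · exact ⟨𝒮, rfl, h0, fun _ _ => rfl, fun _ => rfl, h⟩
  obtain ⟨L, hL, hcons⟩ := h.exists_modulus
  have he : 0 < AddMonoid.exponent K := AddMonoid.exponent_pos_of_exists
    (Nat.card K) Nat.card_pos fun _ => card_nsmul_eq_zero'
  refine ⟨⟨fun s r => 𝒮.coeff s r + L * AddMonoid.exponent K * |𝒮.coeff s r|, 𝒮.rhs⟩, rfl,
    fun s r => ?_, fun s r => ?_, fun h' => absurd h' h0, hcons _ rfl fun s r => ?_⟩
  · have h1 : (1 : ℤ) ≤ L * AddMonoid.exponent K := by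
      exact_mod_cast Nat.mul_pos hL he
    have h2 := neg_abs_le (𝒮.coeff s r)
    have h3 := le_mul_of_one_le_left (abs_nonneg (𝒮.coeff s r)) h1
    change 0 ≤ 𝒮.coeff s r + L * AddMonoid.exponent K * |𝒮.coeff s r|
    linarith
  · exact (Int.modEq_iff_dvd.mpr ⟨L * |𝒮.coeff s r|, by ring⟩).symm
  · exact ⟨AddMonoid.exponent K * |𝒮.coeff s r|, by ring⟩

lemma infinite_admissible [Finite K] : {N | 𝒮.Admissible N}.Infinite := by
  have he : 0 < AddMonoid.exponent K := AddMonoid.exponent_pos_of_exists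
    (Nat.card K) Nat.card_pos fun _ => card_nsmul_eq_zero'
  refine Set.infinite_of_forall_exists_gt fun a => ?_
  set T := ∑ s, (∑ r, 𝒮.coeff s r).natAbs with hT
  have hle : a + T ≤ AddMonoid.exponent K * (a + T) := Nat.le_mul_of_pos_left _ he
  refine ⟨AddMonoid.exponent K * (a + T) + 1, ⟨Nat.succ_pos _, fun s => ?_, ?_⟩, by omega⟩
  · have h1 : (∑ r, 𝒮.coeff s r).natAbs ≤ T :=
      Finset.single_le_sum (f := fun s => (∑ r, 𝒮.coeff s r).natAbs) (fun _ _ => Nat.zero_le _)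
        (Finset.mem_univ s)
    omega
  · simp [Nat.coprime_comm]

/-- The system with the single equation `n • y = a`. -/
def single (n : ℤ) (a : K) : IntSystem K 1 1 := ⟨fun _ _ => n, fun _ => a⟩

lemma single_consistent {n : ℤ} (hn : n ≠ 0) (a : K) : (single n a).Consistent := by
  intro c hc
  have := hc 0
  simp only [single, Fin.sum_univ_one, Fin.isValue, mul_eq_zero, hn, or_false] at this
  simp [this]

lemma single_not_solvable {a : K} (ha : a ≠ 0) :
    ¬ (single (AddMonoid.exponent K) a).Solvable := by
  rintro ⟨y, hy⟩
  have := hy 0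
  simp only [single, Fin.sum_univ_one, natCast_zsmul, AddMonoid.exponent_nsmul_eq_zero] at this
  exact ha this.symm

lemma exists_consistent_not_solvable (K : Type*) [AddCommGroup K] [Finite K] [Nontrivial K] :
    ∃ (S M : ℕ) (𝒮 : IntSystem K S M), 𝒮.Consistent ∧ ¬ 𝒮.Solvable := by
  have he : AddMonoid.exponent K ≠ 0 := AddMonoid.exponent_ne_zero_of_finite
  obtain ⟨a, ha⟩ := exists_ne (0 : K)
  exact ⟨1, 1, _, single_consistent (Nat.cast_ne_zero.mpr he) a, single_not_solvable ha⟩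

end IntSystem

/-! ## The group algebra and the algebra of an orthonormal basis -/

section Models

variable {K : Type u} [Fintype K]
variable {H : Type v} [NormedAddCommGroup H] [InnerProductSpace ℂ H]
variable (b : OrthonormalBasis K ℂ H)

lemma basis_induction {b : OrthonormalBasis K ℂ H} {p : H → Prop} (x : H) (basis : ∀ g, p (b g))
    (zero : p 0) (add : ∀ x y, p x → p y → p (x + y)) (smul : ∀ (c : ℂ) x, p x → p (c • x)) :
    p x := by
  have hx : x ∈ Submodule.span ℂ (Set.range b) := by
    rw [← b.coe_toBasis, b.toBasis.span_eq]
    trivial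
  induction hx using Submodule.span_induction with
  | mem x hx => obtain ⟨g, rfl⟩ := hx; exact basis g
  | zero => exact zero
  | add x y _ _ hx hy => exact add x y hx hy
  | smul c x _ hx => exact smul c x hx

lemma hom_ext_basis {W : Type*} [AddCommMonoid W] [Module ℂ W] {f f' : H →ₗ[ℂ] W}
    (h : ∀ g, f (b g) = f' (b g)) : f = f' :=
  b.toBasis.ext fun g => by rw [b.coe_toBasis]; exact h g

lemma tensor_hom_ext_basis {W : Type*} [AddCommMonoid W] [Module ℂ W] {f f' : H ⊗[ℂ] H →ₗ[ℂ] W}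
    (h : ∀ g g', f (b g ⊗ₜ b g') = f' (b g ⊗ₜ b g')) : f = f' :=
  TensorProduct.ext (hom_ext_basis b fun g => hom_ext_basis b fun g' => h g g')

/-- The linear map given by its values on the basis. -/
def basisMap {W : Type*} [AddCommMonoid W] [Module ℂ W] (f : K → W) : H →ₗ[ℂ] W :=
  b.toBasis.constr ℂ f

@[simp] lemma basisMap_apply {W : Type*} [AddCommMonoid W] [Module ℂ W] (f : K → W) (g : K) :
    basisMap b f (b g) = f g := by
  rw [basisMap, ← b.coe_toBasis, Module.Basis.constr_basis]

lemma inner_basis [DecidableEq K] (g h : K) : ⟪b g, b h⟫_ℂ = if g = h then 1 else 0 :=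
  orthonormal_iff_ite.mp b.orthonormal g h

lemma eq_adjoint_of_basis [FiniteDimensional ℂ H] (m : H ⊗[ℂ] H →ₗ[ℂ] H) (d : H →ₗ[ℂ] H ⊗[ℂ] H)
    (h : ∀ k g g', ⟪d (b k), b g ⊗ₜ b g'⟫_ℂ = ⟪b k, m (b g ⊗ₜ b g')⟫_ℂ) :
    LinearMap.adjoint m = d := by
  symm
  rw [LinearMap.eq_adjoint_iff_basis b.toBasis (b.toBasis.tensorProduct b.toBasis)]
  rintro k ⟨g, g'⟩
  simpa [Module.Basis.tensorProduct_apply] using h k g g'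

/-- The comultiplication which copies the basis. -/
def copyComul : H →ₗ[ℂ] H ⊗[ℂ] H := basisMap b fun k => b k ⊗ₜ b k

@[simp] lemma copyComul_apply (k : K) : copyComul b (b k) = b k ⊗ₜ b k := by
  simp [copyComul]

section Copy

variable [DecidableEq K]

/-- The multiplication of the algebra which copies the basis. -/
def copyMul : H ⊗[ℂ] H →ₗ[ℂ] H :=
  TensorProduct.lift (basisMap b fun g => basisMap b fun h => if g = h then b g else 0)

@[simp] lemma copyMul_apply (g h : K) :
    copyMul b (b g ⊗ₜ b h) = if g = h then b g else 0 := by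
  simp [copyMul]

@[simp] lemma adjoint_copyMul [FiniteDimensional ℂ H] :
    LinearMap.adjoint (copyMul b) = copyComul b := by
  refine eq_adjoint_of_basis b _ _ fun k g g' => ?_
  simp only [copyComul_apply, TensorProduct.inner_tmul, inner_basis, copyMul_apply]
  split_ifs <;> simp_all

lemma copyMul_assoc (x y z : H) :
    copyMul b (copyMul b (x ⊗ₜ y) ⊗ₜ z) = copyMul b (x ⊗ₜ copyMul b (y ⊗ₜ z)) := by
  induction x using basis_induction (b := b) with
  | zero => simp
  | add x y hx hy => simp only [TensorProduct.add_tmul, map_add, hx, hy]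
  | smul c x hx => simp only [← TensorProduct.smul_tmul', map_smul, hx]
  | basis g =>
    induction y using basis_induction (b := b) with
    | zero => simp
    | add x y hx hy => simp only [TensorProduct.add_tmul, TensorProduct.tmul_add, map_add, hx, hy]
    | smul c x hx =>
      simp only [← TensorProduct.smul_tmul', TensorProduct.tmul_smul, map_smul, hx]
    | basis h =>
      induction z using basis_induction (b := b) with
      | zero => simp
      | add x y hx hy => simp only [TensorProduct.tmul_add, map_add, hx, hy]
      | smul c x hx => simp only [TensorProduct.tmul_smul, map_smul, hx]
      | basis k =>
        by_cases h1 : g = h <;> by_cases h2 : h = k <;> simp [h1, h2]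
        simp [← h2, h1]

lemma copyMul_comm (x y : H) : copyMul b (x ⊗ₜ y) = copyMul b (y ⊗ₜ x) := by
  refine LinearMap.congr_fun (f := copyMul b) (g := copyMul b ∘ₗ
    (TensorProduct.comm ℂ H H).toLinearMap) (tensor_hom_ext_basis b fun g g' => ?_) (x ⊗ₜ y)
  by_cases h : g = g' <;> simp [h, eq_comm]

lemma copyMul_unit (x : H) : copyMul b ((∑ g, b g) ⊗ₜ x) = x := by
  refine LinearMap.congr_fun (f := copyMul b ∘ₗ TensorProduct.mk ℂ H H (∑ g, b g))
    (g := LinearMap.id) (hom_ext_basis b fun g => ?_) x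
  simp

variable [FiniteDimensional ℂ H]

/-- The algebra which copies an orthonormal basis. -/
def copyFrobenius : DaggerFrobenius H where
  mul := copyMul b
  unit := ∑ g, b g
  mul_assoc := copyMul_assoc b
  unit_mul := copyMul_unit b
  mul_unit x := by rw [copyMul_comm, copyMul_unit]
  frobenius_left := by
    refine tensor_hom_ext_basis b fun g h => ?_
    by_cases hgh : g = h <;> simp [hgh]
  frobenius_right := by
    refine tensor_hom_ext_basis b fun g h => ?_
    by_cases hgh : g = h <;> simp [hgh]

lemma copyFrobenius_comul : (copyFrobenius b).comul = copyComul b := adjoint_copyMul b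

lemma copyFrobenius_isCommutative : (copyFrobenius b).IsCommutative := copyMul_comm b

lemma copyFrobenius_isSpecial : (copyFrobenius b).IsSpecial := by
  rw [DaggerFrobenius.IsSpecial, copyFrobenius_comul]
  refine hom_ext_basis b fun g => ?_
  simp [copyFrobenius]

lemma copyFrobenius_counit (g : K) : (copyFrobenius b).counit (b g) = 1 := by
  change ⟪∑ h, b h, b g⟫_ℂ = _
  simp [inner_basis]

lemma isClassical_basis (g : K) : (copyFrobenius b).IsClassical (b g) := by
  refine ⟨by rw [copyFrobenius_comul, copyComul_apply], fun φ => ?_, copyFrobenius_counit b g⟩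
  refine LinearMap.congr_fun (f := (copyFrobenius b).counit ∘ₗ (copyFrobenius b).mul ∘ₗ
    TensorProduct.mk ℂ H H (b g)) (g := (innerₛₗ ℂ (b g) : H →ₗ[ℂ] ℂ))
    (hom_ext_basis b fun h => ?_) φ
  have hm : (copyFrobenius b).mul (b g ⊗ₜ b h) = if g = h then b g else 0 := copyMul_apply b g h
  rw [LinearMap.comp_apply, LinearMap.comp_apply, TensorProduct.mk_apply, hm,
    innerₛₗ_apply_apply, inner_basis]
  split_ifs
  · exact copyFrobenius_counit b g
  · exact map_zero _

lemma exists_basis_eq_of_isClassical {ψ : H} (h : (copyFrobenius b).IsClassical ψ) :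
    ∃ g, b g = ψ := by
  by_contra! hne
  have h0 : ψ = 0 := by
    rw [← b.sum_repr' ψ]
    refine Finset.sum_eq_zero fun g _ => ?_
    rw [(isClassical_basis b g).inner_eq_zero (copyFrobenius_isSpecial b) h (hne g), zero_smul]
  have h1 := h.inner_self (copyFrobenius_isSpecial b)
  rw [h0, inner_zero_left] at h1
  exact zero_ne_one h1

/-- The classical states of `copyFrobenius` are labelled by the basis. -/
def basisLabel : K ≃ {ψ : H // (copyFrobenius b).IsClassical ψ} :=
  Equiv.ofBijective (fun g => ⟨b g, isClassical_basis b g⟩)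
    ⟨fun _ _ h => b.orthonormal.linearIndependent.injective (congrArg Subtype.val h),
      fun ψ => (exists_basis_eq_of_isClassical b ψ.2).imp fun _ h => Subtype.ext h⟩

lemma copyFrobenius_hasEnoughClassical : (copyFrobenius b).HasEnoughClassical :=
  fun _ _ _ _ _ _ h => hom_ext_basis b fun g => h _ (isClassical_basis b g)

end Copy

variable [AddCommGroup K]

/-- The multiplication of the group algebra. -/
def groupMul : H ⊗[ℂ] H →ₗ[ℂ] H :=
  TensorProduct.lift (basisMap b fun g => basisMap b fun h => b (g + h))

@[simp] lemma groupMul_apply (g h : K) : groupMul b (b g ⊗ₜ b h) = b (g + h) := by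
  simp [groupMul]

/-- The comultiplication adjoint to `groupMul`. -/
def groupComul : H →ₗ[ℂ] H ⊗[ℂ] H := basisMap b fun k => ∑ g, b g ⊗ₜ b (k - g)

@[simp] lemma groupComul_apply (k : K) : groupComul b (b k) = ∑ g, b g ⊗ₜ b (k - g) := by
  simp [groupComul]

@[simp] lemma adjoint_groupMul [FiniteDimensional ℂ H] :
    LinearMap.adjoint (groupMul b) = groupComul b := by
  classical
  refine eq_adjoint_of_basis b _ _ fun k g g' => ?_
  simp only [groupComul_apply, sum_inner, TensorProduct.inner_tmul, inner_basis, groupMul_apply]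
  rw [Finset.sum_eq_single g]
  · simp [sub_eq_iff_eq_add']
  · intro h _ hne
    simp [hne]
  · simp

lemma groupMul_assoc (x y z : H) :
    groupMul b (groupMul b (x ⊗ₜ y) ⊗ₜ z) = groupMul b (x ⊗ₜ groupMul b (y ⊗ₜ z)) := by
  induction x using basis_induction (b := b) with
  | zero => simp
  | add x y hx hy => simp only [TensorProduct.add_tmul, map_add, hx, hy]
  | smul c x hx => simp only [← TensorProduct.smul_tmul', map_smul, hx]
  | basis g =>
    induction y using basis_induction (b := b) with
    | zero => simp
    | add x y hx hy => simp only [TensorProduct.add_tmul, TensorProduct.tmul_add, map_add, hx, hy]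
    | smul c x hx =>
      simp only [← TensorProduct.smul_tmul', TensorProduct.tmul_smul, map_smul, hx]
    | basis h =>
      induction z using basis_induction (b := b) with
      | zero => simp
      | add x y hx hy => simp only [TensorProduct.tmul_add, map_add, hx, hy]
      | smul c x hx => simp only [TensorProduct.tmul_smul, map_smul, hx]
      | basis k => simp [add_assoc]

lemma groupMul_comm (x y : H) : groupMul b (x ⊗ₜ y) = groupMul b (y ⊗ₜ x) := by
  refine LinearMap.congr_fun (f := groupMul b) (g := groupMul b ∘ₗ
    (TensorProduct.comm ℂ H H).toLinearMap) (tensor_hom_ext_basis b fun g g' => ?_) (x ⊗ₜ y)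
  simp [add_comm]

lemma groupMul_unit (x : H) : groupMul b (b 0 ⊗ₜ x) = x := by
  refine LinearMap.congr_fun (f := groupMul b ∘ₗ TensorProduct.mk ℂ H H (b 0))
    (g := LinearMap.id) (hom_ext_basis b fun g => ?_) x
  simp

/-- The Fourier coefficient at a character. -/
def fourierCoeff (χ : AddChar K ℂ) : H →ₗ[ℂ] ℂ := basisMap b χ

@[simp] lemma fourierCoeff_basis (χ : AddChar K ℂ) (g : K) : fourierCoeff b χ (b g) = χ g := by
  simp [fourierCoeff]

/-- Parseval's identity. -/
lemma card_mul_inner (x y : H) :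
    (Fintype.card K : ℂ) * ⟪x, y⟫_ℂ =
      ∑ χ : AddChar K ℂ, starRingEnd ℂ (fourierCoeff b χ x) * fourierCoeff b χ y := by
  classical
  induction x using basis_induction (b := b) with
  | zero => simp
  | add x y hx hy => simp only [map_add, inner_add_left, mul_add, add_mul, Finset.sum_add_distrib,
      hx, hy]
  | smul c x hx =>
    simp only [map_smul, inner_smul_left, smul_eq_mul, map_mul, mul_assoc, ← Finset.mul_sum, ← hx]
    ring
  | basis g =>
    induction y using basis_induction (b := b) with
    | zero => simp
    | add x y hx hy => simp only [map_add, inner_add_right, mul_add, Finset.sum_add_distrib, hx, hy]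
    | smul c x hx =>
      simp only [map_smul, inner_smul_right, smul_eq_mul, mul_left_comm _ c, ← Finset.mul_sum, ← hx]
    | basis h =>
      simp only [fourierCoeff_basis, inner_basis, ← AddChar.map_neg_eq_conj,
        ← AddChar.map_add_eq_mul, AddChar.sum_apply_eq_ite]
      simp [neg_add_eq_zero]

variable [FiniteDimensional ℂ H]

/-- The group algebra, on a Hilbert space with an orthonormal basis indexed by the group. -/
def groupFrobenius : DaggerFrobenius H where
  mul := groupMul b
  unit := b 0
  mul_assoc := groupMul_assoc b
  unit_mul := groupMul_unit b
  mul_unit x := by rw [groupMul_comm, groupMul_unit]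
  frobenius_left := by
    refine tensor_hom_ext_basis b fun g h => ?_
    simp only [LinearMap.comp_apply, LinearEquiv.coe_coe, LinearMap.lTensor_tmul,
      adjoint_groupMul, groupComul_apply, groupMul_apply, TensorProduct.tmul_sum, map_sum,
      TensorProduct.assoc_symm_tmul, LinearMap.rTensor_tmul]
    exact Fintype.sum_equiv (Equiv.addLeft g) _ _ fun k => by
      rw [Equiv.coe_addLeft, add_sub_add_left_eq_sub]
  frobenius_right := by
    refine tensor_hom_ext_basis b fun g h => ?_
    simp only [LinearMap.comp_apply, LinearEquiv.coe_coe, LinearMap.rTensor_tmul,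
      adjoint_groupMul, groupComul_apply, groupMul_apply, TensorProduct.sum_tmul, map_sum,
      TensorProduct.assoc_tmul, LinearMap.lTensor_tmul]
    exact Finset.sum_congr rfl fun k _ => by rw [sub_add_eq_add_sub]

lemma groupFrobenius_comul : (groupFrobenius b).comul = groupComul b := adjoint_groupMul b

lemma groupFrobenius_isCommutative : (groupFrobenius b).IsCommutative := groupMul_comm b

lemma groupFrobenius_isQuasiSpecial : (groupFrobenius b).IsQuasiSpecial := by
  have hc : (0 : ℝ) < Fintype.card K := by exact_mod_cast Fintype.card_pos_iff.mpr ⟨(0 : K)⟩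
  refine ⟨(Real.sqrt (Fintype.card K) : ℂ), ?_, ?_⟩
  · exact_mod_cast (Real.sqrt_pos.mpr hc).ne'
  · have hs : star (Real.sqrt (Fintype.card K) : ℂ) * (Real.sqrt (Fintype.card K) : ℂ) =
        (Fintype.card K : ℂ) := by
      rw [Complex.star_def, Complex.conj_ofReal, ← Complex.ofReal_mul, Real.mul_self_sqrt hc.le,
        Complex.ofReal_natCast]
    rw [hs, groupFrobenius_comul]
    refine hom_ext_basis b fun g => ?_
    simp [groupFrobenius, Nat.cast_smul_eq_nsmul]

lemma fourierCoeff_mul (χ : AddChar K ℂ) (x y : H) :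
    fourierCoeff b χ ((groupFrobenius b).mul (x ⊗ₜ y)) =
      fourierCoeff b χ x * fourierCoeff b χ y := by
  refine LinearMap.congr_fun (f := fourierCoeff b χ ∘ₗ (groupFrobenius b).mul)
    (g := LinearMap.mul' ℂ ℂ ∘ₗ TensorProduct.map (fourierCoeff b χ) (fourierCoeff b χ))
    (tensor_hom_ext_basis b fun g h => ?_) (x ⊗ₜ y)
  have hmul : (groupFrobenius b).mul (b g ⊗ₜ b h) = b (g + h) := groupMul_apply b g h
  simp [hmul, AddChar.map_add_eq_mul]

variable [DecidableEq K]

lemma groupFrobenius_counit (g : K) : (groupFrobenius b).counit (b g) = if g = 0 then 1 else 0 := by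
  change ⟪b 0, b g⟫_ℂ = _
  rw [inner_basis]
  simp [eq_comm]

lemma antipode_basis (g : K) :
    DaggerFrobenius.antipode (groupFrobenius b) (copyFrobenius b) (b g) = b (-g) := by
  have hcup : (copyFrobenius b).comul (copyFrobenius b).unit = ∑ h, b h ⊗ₜ[ℂ] b h := by
    rw [copyFrobenius_comul]
    simp [copyFrobenius]
  have hmul : ∀ h, (groupFrobenius b).mul (b g ⊗ₜ b h) = b (g + h) := groupMul_apply b g
  change TensorProduct.lid ℂ H (((groupFrobenius b).counit ∘ₗ (groupFrobenius b).mul).rTensor H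
    ((TensorProduct.assoc ℂ H H H).symm
      (b g ⊗ₜ (copyFrobenius b).comul (copyFrobenius b).unit))) = _
  simp only [hcup, TensorProduct.tmul_sum, map_sum, TensorProduct.assoc_symm_tmul,
    LinearMap.rTensor_tmul, LinearMap.comp_apply, TensorProduct.lid_tmul, hmul,
    groupFrobenius_counit]
  rw [Finset.sum_eq_single (-g)]
  · simp
  · intro h _ hne
    rw [if_neg fun h0 => hne (eq_neg_of_add_eq_zero_right h0), zero_smul]
  · simp

lemma antipode_eq_basisMap :
    DaggerFrobenius.antipode (groupFrobenius b) (copyFrobenius b) =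
      basisMap b fun g => b (-g) :=
  hom_ext_basis b fun g => by rw [antipode_basis, basisMap_apply]

lemma stronglyComplementary_group_copy :
    (groupFrobenius b).StronglyComplementary (copyFrobenius b) where
  antipode_selfAdjoint x y := by
    rw [antipode_eq_basisMap]
    induction x using basis_induction (b := b) with
    | zero => simp
    | add x y hx hy => simp only [map_add, inner_add_left, hx, hy]
    | smul c x hx => simp only [map_smul, inner_smul_left, hx]
    | basis g =>
      induction y using basis_induction (b := b) with
      | zero => simp
      | add x y hx hy => simp only [map_add, inner_add_right, hx, hy]
      | smul c x hx => simp only [map_smul, inner_smul_right, hx]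
      | basis h => simp [inner_basis, neg_eq_iff_eq_neg]
  antipode_involutive x := by
    rw [antipode_eq_basisMap]
    refine LinearMap.congr_fun (f := (basisMap b fun g => b (-g)) ∘ₗ basisMap b fun g => b (-g))
      (g := LinearMap.id) (hom_ext_basis b fun g => ?_) x
    simp
  hopf x := by
    refine LinearMap.congr_fun (f := (groupFrobenius b).mul ∘ₗ
      (DaggerFrobenius.antipode (groupFrobenius b) (copyFrobenius b)).lTensor H ∘ₗ
        (copyFrobenius b).comul) (g := (copyFrobenius b).counit.smulRight (groupFrobenius b).unit)
      (hom_ext_basis b fun g => ?_) x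
    have hmul : (groupFrobenius b).mul (b g ⊗ₜ b (-g)) = b (g + -g) := groupMul_apply b g (-g)
    rw [copyFrobenius_comul, LinearMap.comp_apply, LinearMap.comp_apply, copyComul_apply,
      LinearMap.lTensor_tmul, antipode_basis, hmul, add_neg_cancel, LinearMap.smulRight_apply,
      copyFrobenius_counit, one_smul]
    rfl
  comul_unit := by
    rw [copyFrobenius_comul]
    exact copyComul_apply b 0
  counit_unit := copyFrobenius_counit b 0
  comul_mul := by
    rw [copyFrobenius_comul]
    refine tensor_hom_ext_basis b fun g h => ?_
    simp [groupFrobenius]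
  counit_mul x y := by
    refine LinearMap.congr_fun (f := (copyFrobenius b).counit ∘ₗ (groupFrobenius b).mul)
      (g := LinearMap.mul' ℂ ℂ ∘ₗ
        TensorProduct.map (copyFrobenius b).counit (copyFrobenius b).counit)
      (tensor_hom_ext_basis b fun g h => ?_) (x ⊗ₜ y)
    have hmul : (groupFrobenius b).mul (b g ⊗ₜ b h) = b (g + h) := groupMul_apply b g h
    simp [hmul, copyFrobenius_counit]

lemma eq_of_fourierCoeff_eq {x y : H} (h : ∀ χ, fourierCoeff b χ x = fourierCoeff b χ y) :
    x = y := by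
  rw [← sub_eq_zero, ← inner_self_eq_zero (𝕜 := ℂ)]
  have hc : (Fintype.card K : ℂ) ≠ 0 := Nat.cast_ne_zero.mpr Fintype.card_ne_zero
  refine (mul_eq_zero.mp ?_).resolve_left hc
  rw [card_mul_inner b]
  refine Finset.sum_eq_zero fun χ _ => ?_
  rw [map_sub, h, sub_self, mul_zero]

lemma exists_fourierCoeff_eq (y : AddChar K ℂ → ℂ) : ∃ x : H, ∀ χ, fourierCoeff b χ x = y χ := by
  have hinj : Function.Injective (LinearMap.pi fun χ => fourierCoeff b χ) := fun x y h =>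
    eq_of_fourierCoeff_eq b fun χ => congrFun h χ
  have hdim : Module.finrank ℂ H = Module.finrank ℂ (AddChar K ℂ → ℂ) := by
    rw [Module.finrank_eq_card_basis b.toBasis, Module.finrank_fintype_fun_eq_card, AddChar.card_eq]
  obtain ⟨x, hx⟩ := (LinearMap.injective_iff_surjective_of_finrank_eq_finrank hdim).mp hinj y
  exact ⟨x, fun χ => congrFun hx χ⟩

lemma DaggerFrobenius.isPhaseState_of_forall_inner (Z : DaggerFrobenius H) {u : H}
    (h : ∀ v, ⟪Z.mul (u ⊗ₜ v), u⟫_ℂ = ⟪v, Z.unit⟫_ℂ) : Z.IsPhaseState u := by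
  refine ext_inner_left ℂ fun v => ?_
  rw [← h, ← Z.inner_comul]
  induction Z.comul u using TensorProduct.induction_on with
  | zero => simp
  | tmul x y => simp [inner_smul_right]
  | add x y hx hy => simp only [map_add, inner_add_right, hx, hy]

lemma isPhaseState_of_norm_fourierCoeff {x : H} (h : ∀ χ, ‖fourierCoeff b χ x‖ = 1) :
    (groupFrobenius b).IsPhaseState x := by
  refine DaggerFrobenius.isPhaseState_of_forall_inner _ fun y => ?_
  have hc : (Fintype.card K : ℂ) ≠ 0 := Nat.cast_ne_zero.mpr Fintype.card_ne_zero
  refine mul_left_cancel₀ hc ?_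
  rw [card_mul_inner b, card_mul_inner b]
  refine Finset.sum_congr rfl fun χ _ => ?_
  have hu : fourierCoeff b χ (groupFrobenius b).unit = 1 := by
    rw [show (groupFrobenius b).unit = b 0 from rfl, fourierCoeff_basis, AddChar.map_zero_eq_one]
  rw [fourierCoeff_mul, hu, map_mul, mul_right_comm, ← Complex.normSq_eq_conj_mul_self,
    Complex.normSq_eq_norm_sq, h]
  simp

end Models

/-! ## Arguments for consistent systems -/

lemma circle_nsmul_surjective {n : ℤ} (hn : n ≠ 0) :
    Function.Surjective fun z : Additive Circle => n • z := fun z => by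
  obtain ⟨x, hx⟩ := Circle.exp_surjective z.toMul
  refine ⟨Additive.ofMul (Circle.exp (x / n)), ?_⟩
  change Additive.ofMul (Circle.exp (x / n) ^ n) = z
  rw [← Circle.exp_intCast_mul, mul_div_cancel₀ _ (Int.cast_ne_zero.mpr hn), hx]
  rfl

section Construction

variable {K : Type u} [AddCommGroup K] [Finite K] {S M : ℕ} {𝒮 : IntSystem K S M} {N : ℕ}
variable {H : Type v} [NormedAddCommGroup H] [InnerProductSpace ℂ H] [FiniteDimensional ℂ H]

theorem exists_merminArgument (hcons : 𝒮.Consistent) (h0 : ∀ s r, 0 ≤ 𝒮.coeff s r)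
    (hN : 𝒮.Admissible N) (hdim : Module.finrank ℂ H = Nat.card K) :
    Nonempty (MerminArgument H 𝒮 N) := by
  classical
  have : Fintype K := Fintype.ofFinite K
  have hcard : Fintype.card K = Fintype.card (Fin (Module.finrank ℂ H)) := by
    rw [Fintype.card_fin, hdim, Nat.card_eq_fintype_card]
  let b : OrthonormalBasis K ℂ H :=
    (stdOrthonormalBasis ℂ H).reindex (Fintype.equivOfCardEq hcard).symm
  let _ : DivisibleBy (Additive Circle) ℤ :=
    divisibleByOfSMulRightSurj _ _ fun hn => circle_nsmul_surjective hn
  have hsol : ∀ χ : AddChar K ℂ, ∃ y : Fin M → Circle, ∀ s,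
      ∏ r, ((y r : Circle) : ℂ) ^ (𝒮.coeff s r).toNat = χ (𝒮.rhs s) := fun χ => by
    obtain ⟨y, hy⟩ := hcons.exists_solution_of_divisible
      (AddChar.circleEquivComplex.symm χ).toAddMonoidHom
    refine ⟨fun r => (y r).toMul, fun s => ?_⟩
    have h1 : ∏ r, (y r).toMul ^ (𝒮.coeff s r).toNat =
        AddChar.circleEquivComplex.symm χ (𝒮.rhs s) := by
      have h2 := congrArg Additive.toMul (hy s)
      rw [toMul_sum] at h2
      refine Eq.trans (Finset.prod_congr rfl fun r _ => ?_) h2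
      rw [toMul_zsmul, ← zpow_natCast, Int.toNat_of_nonneg (h0 s r)]
    have h3 := congrArg Circle.coeHom h1
    simp only [map_prod, map_pow] at h3
    exact h3
  choose y hy using hsol
  choose β hβ using fun r => exists_fourierCoeff_eq b fun χ => (y χ r : ℂ)
  refine ⟨{
    Z := groupFrobenius b
    X := copyFrobenius b
    Z_comm := groupFrobenius_isCommutative b
    Z_quasiSpecial := groupFrobenius_isQuasiSpecial b
    X_comm := copyFrobenius_isCommutative b
    X_special := copyFrobenius_isSpecial b
    stronglyComplementary := stronglyComplementary_group_copy b
    X_enough := copyFrobenius_hasEnoughClassical b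
    label := basisLabel b
    label_zero := rfl
    label_add := fun g h => (groupMul_apply b g h).symm
    coeff_nonneg := h0
    admissible := hN
    β := β
    β_phase := fun r => isPhaseState_of_norm_fourierCoeff b fun χ => by
      rw [hβ, Circle.norm_coe]
    β_solution := fun s => ⟨1, norm_one, ?_⟩ }⟩
  rw [(groupFrobenius b).prod_gate_pow_unit (groupFrobenius_isCommutative b), one_smul]
  refine eq_of_fourierCoeff_eq b fun χ => ?_
  let _ := (groupFrobenius b).commMonoid (groupFrobenius_isCommutative b)
  let F : H →* ℂ :=
    { toFun := fourierCoeff b χ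
      map_one' := (fourierCoeff_basis b χ 0).trans χ.map_zero_eq_one
      map_mul' := fourierCoeff_mul b χ }
  have hF : F (∏ r, β r ^ (𝒮.coeff s r).toNat) = χ (𝒮.rhs s) := by
    rw [map_prod, ← hy]
    refine Finset.prod_congr rfl fun r _ => ?_
    rw [map_pow]
    exact congrArg (· ^ _) (hβ r χ)
  exact hF.trans (fourierCoeff_basis b χ _).symm

end Construction

end Mermin

end

open Mermin
theorem mainTheorem5 :
    -- Every argument in quantum theory whose system has no solution in `K` defines, by the Born
    -- rule, an empirical model which is `AvN_{ℤ,K}`.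
    (∀ (K : Type u) [AddCommGroup K] [Finite K]
        (H : Type v) [NormedAddCommGroup H] [InnerProductSpace ℂ H] [FiniteDimensional ℂ H]
        (S M N : ℕ) (𝒮 : IntSystem K S M) (A : MerminArgument H 𝒮 N),
        ¬ 𝒮.Solvable →
        ∃ ζ : EmpiricalModel (merminScenario 𝒮 N) ℝ≥0 K,
          A.Realises ζ ∧ ζ.collapse.IsAvN ℤ K) ∧
    -- The family is indexed by all finite abelian groups and all consistent unsolvable systems.
    -- The parties are counted by representatives of the coefficients which are nonnegative, and
    -- which are the coefficients themselves if these are nonnegative.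
    (∀ (K : Type u) [AddCommGroup K] [Finite K] (S M : ℕ) (𝒮 : IntSystem K S M),
        𝒮.Consistent → ¬ 𝒮.Solvable →
        ∃ 𝒮' : IntSystem K S M,
          𝒮'.rhs = 𝒮.rhs ∧
          (∀ s r, 0 ≤ 𝒮'.coeff s r) ∧
          (∀ s r, 𝒮'.coeff s r ≡ 𝒮.coeff s r [ZMOD (AddMonoid.exponent K : ℤ)]) ∧
          ((∀ s r, 0 ≤ 𝒮.coeff s r) → 𝒮' = 𝒮) ∧
          𝒮'.Consistent ∧ ¬ 𝒮'.Solvable ∧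
          {N | 𝒮'.Admissible N}.Infinite ∧
          ∀ (N : ℕ), 𝒮'.Admissible N →
            ∀ (H : Type v) [NormedAddCommGroup H] [InnerProductSpace ℂ H]
              [FiniteDimensional ℂ H], Module.finrank ℂ H = Nat.card K →
              ∃ (A : MerminArgument H 𝒮' N)
                (ζ : EmpiricalModel (merminScenario 𝒮' N) ℝ≥0 K),
                A.Realises ζ ∧ ζ.collapse.IsAvN ℤ K) ∧
    -- The family is infinite: every nontrivial finite abelian group occurs.
    (∀ (K : Type u) [AddCommGroup K] [Finite K] [Nontrivial K],
        ∃ (S M : ℕ) (𝒮 : IntSystem K S M), 𝒮.Consistent ∧ ¬ 𝒮.Solvable) ∧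
    -- For empirical models with outcomes in `K`, being `AvN_{ℤ,K}` and being `AvN_{ℤ/n,K}` are
    -- equivalent whenever the exponent of `K` divides `n`.
    (∀ (K : Type u) [AddCommGroup K] [Finite K] (n : ℕ) (_ : 0 < n)
        (h : AddMonoid.exponent K ∣ n)
        (X : Type w) [DecidableEq X] (𝒮c : Scenario X) (ζ : EmpiricalModel 𝒮c Poss K),
        ζ.IsAvN ℤ K ↔ @EmpiricalModel.IsAvN X (ZMod n) K _ _ (zmodModule K n h) _ _ ζ) ∧
    -- For every `n ≥ 2` some argument gives a quantum-realisable `AvN_{ℤ/n}` model.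
    (∀ n : ℕ, 2 ≤ n →
        ∃ (S M N : ℕ) (𝒮 : IntSystem (ZMod n) S M),
          𝒮.Consistent ∧ ¬ 𝒮.Solvable ∧
          ∀ (H : Type v) [NormedAddCommGroup H] [InnerProductSpace ℂ H] [FiniteDimensional ℂ H],
            Module.finrank ℂ H = n →
            ∃ (A : MerminArgument H 𝒮 N) (ζ : EmpiricalModel (merminScenario 𝒮 N) ℝ≥0 (ZMod n)),
              A.Realises ζ ∧ ζ.collapse.IsAvN (ZMod n) (ZMod n)) := by
  refine ⟨fun K _ _ H _ _ _ S M N 𝒮 A h => A.exists_realises_isAvN h, ?_,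
    fun K _ _ _ => IntSystem.exists_consistent_not_solvable K, ?_, ?_⟩
  · intro K _ _ S M 𝒮 hc hs
    obtain ⟨𝒮', hrhs, h0, hmod, heq, hc'⟩ := hc.exists_nonneg
    have hs' : ¬ 𝒮'.Solvable := fun h => hs (h.of_modEq hrhs hmod)
    refine ⟨𝒮', hrhs, h0, hmod, heq, hc', hs', IntSystem.infinite_admissible, ?_⟩
    intro N hN H _ _ _ hdim
    obtain ⟨A⟩ := exists_merminArgument hc' h0 hN hdim
    obtain ⟨ζ, hζ⟩ := A.exists_realises_isAvN hs'
    exact ⟨A, ζ, hζ⟩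
  · intro K _ _ n _ h X _ 𝒮c ζ
    let _ := zmodModule K n h
    exact isAvN_int_iff_zmod ζ n
  · intro n hn
    have : NeZero n := ⟨by omega⟩
    have : Fact (1 < n) := ⟨hn⟩
    have hexp : AddMonoid.exponent (ZMod n) = n := ZMod.exponent n
    have hc : (IntSystem.single (AddMonoid.exponent (ZMod n)) (1 : ZMod n)).Consistent :=
      IntSystem.single_consistent (by rw [hexp]; exact_mod_cast NeZero.ne n) 1
    have hs : ¬ (IntSystem.single (AddMonoid.exponent (ZMod n)) (1 : ZMod n)).Solvable :=
      IntSystem.single_not_solvable one_ne_zero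
    have hN : (IntSystem.single (AddMonoid.exponent (ZMod n)) (1 : ZMod n)).Admissible (n + 1) :=
      ⟨Nat.succ_pos n, fun s => by simp [IntSystem.single, hexp], by simp [hexp]⟩
    refine ⟨1, 1, n + 1, _, hc, hs, fun H _ _ _ hdim => ?_⟩
    obtain ⟨A⟩ := exists_merminArgument (H := H) hc (fun s r => Int.natCast_nonneg _) hN
      (hdim.trans (Nat.card_zmod n).symm)
    obtain ⟨ζ, hζ, havn⟩ := A.exists_realises_isAvN hs
    exact ⟨A, ζ, hζ, (isAvN_int_iff_zmod _ n).mp havn⟩
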